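/- Let $d,m\in\mathbb N$ and let $M_p$ be the set of point measures on $\mathbb R^d\times\{1,\dots,m\}$, i.e. of Borel measures taking values in $\mathbb N$ on relatively compact Borel sets, with the $\sigma$-algebra generated by the evaluations $\lambda\mapsto\lambda(A)$ (the Borel $\sigma$-algebra of the vague topology). For $\lambda\in M_p$ and $t\in\mathbb R^d$ let $T_t\lambda$ be the translate of $\lambda$ by $t$ (in the first coordinate). Let $\mu$ be a probability measure on $M_p$ (the law of an $m$-coloured point process) which is - uniformly discrete: for some $r>0$, $\mu$-almost every $\lambda$ satisfies $\lambda\big((a+C_r)\times\{1,\dots,m\}\big)\le 1$ for all $a\in\mathbb R^d$, where $C_R$ is the open cube of edge length $R$ about $0$; - stationary and ergodic for the translation action of $\mathbb R^d$. (If $X$ is the vague support of $\mu$, then $L^2(X,\mu)=L^2(M_p,\mu)$.) Let $w=(w_1,\dots,w_m)$ be real numbers, pairwise distinct and all nonzero, let $\lambda^w:=\sum_i w_i\,\lambda(\,\cdot\times\{i\})$, and let $N^w_f(\lambda):=\lambda^w(f)$. Let $\dot\mu^w_1$ be the weighted autocorrelation of $\mu$, that is, the first moment of the weighted Palm measure: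 $$\dot\mu^w_1(f)=\int\ \sum_{x\in C_1}\lambda^w(\{x\})\,N^w_f(T_{-x}\lambda)\,d\mu(\lambda).$$ Let $\mathbb S$ be the space of rapidly decreasing (Schwartz) functions $\mathbb R^d\to\mathbb C$, and $\hat f(k)=\int f(x)e^{-2\pi i k\cdot x}\,dx$. Then there are a positive tempered measure $\sigma=\widehat{\dot\mu^w_1}$ on $\mathbb R^d$ with $\int\varphi\,d\sigma=\dot\mu^w_1(\hat\varphi)$ for all $\varphi\in\mathbb S$, and a linear isometric embedding $\theta^w:L^2(\mathbb R^d,\sigma)\to L^2(X,\mu)$ with $\theta^w(\hat f)=N^w_f$ for all $f\in\mathbb S$. For every such $\sigma$ and $\theta^w$, the complex algebra $\Theta^w$ generated, under pointwise multiplication, by $\theta^w(\mathbb S)$ and the constant function $1_X$ is contained in $L^2(X,\mu)$ and is dense in $L^2(X,\mu)$. -/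

import Mathlib

open MeasureTheory Filter
open scoped ENNReal FourierTransform SchwartzMap

noncomputable section

namespace ColouredPointProcess

/-- The ambient Euclidean space `ℝ^d`. -/
abbrev Space (d : ℕ) : Type := EuclideanSpace ℝ (Fin d)

/-- The open cube of edge length `R` centred at `a`. -/
def cube {d : ℕ} (a : Space d) (R : ℝ) : Set (Space d) :=
  {x | ∀ i, |x i - a i| < R / 2}

/-- Point measures on `ℝ^d × {1, …, m}`: Borel measures that take values in `ℕ` on all
relatively compact Borel sets. -/
def IsPointMeasure {d m : ℕ} (ν : Measure (Space d × Fin m)) : Prop :=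
  ∀ A : Set (Space d × Fin m), MeasurableSet A → IsCompact (closure A) → ∃ n : ℕ, ν A = n

/-- The space `M_p` of point measures on `ℝ^d × {1, …, m}`. -/
def PointMeasure (d m : ℕ) : Type :=
  {ν : Measure (Space d × Fin m) // IsPointMeasure ν}

/-- The `σ`-algebra on point measures generated by the evaluations `ν ↦ ν A`; it is the Borel
`σ`-algebra of the vague topology. -/
instance (d m : ℕ) : MeasurableSpace (PointMeasure d m) :=
  inferInstanceAs (MeasurableSpace {ν : Measure (Space d × Fin m) // IsPointMeasure ν})

/-- Translation of coloured points: `(x, i) ↦ (t + x, i)`. -/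
def shift {d : ℕ} (m : ℕ) (t : Space d) : (Space d × Fin m) ≃ₜ (Space d × Fin m) :=
  (Homeomorph.addLeft t).prodCongr (Homeomorph.refl (Fin m))

theorem IsPointMeasure.map_shift {d m : ℕ} {ν : Measure (Space d × Fin m)}
    (hν : IsPointMeasure ν) (t : Space d) : IsPointMeasure (ν.map (shift m t)) := by
  intro A hA hc
  have hmeas : Measurable (shift m t) := (shift m t).continuous.measurable
  rw [Measure.map_apply hmeas hA]
  refine hν _ (hmeas hA) ?_
  rw [← (shift m t).preimage_closure]
  exact (shift m t).isCompact_preimage.mpr hc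

/-- The translation action of `ℝ^d` on point measures, `(t +ᵥ ν)(A) = ν (-t + A)`. -/
instance (d m : ℕ) : VAdd (Space d) (PointMeasure d m) where
  vadd t ν := ⟨ν.1.map (shift m t), ν.2.map_shift t⟩

/-- A point process (given by its law) is uniformly discrete if, for some `r > 0`, almost every
realisation has at most one point, whatever its colour, in each translate of the open cube of
edge length `r`. -/
def IsUniformlyDiscrete {d m : ℕ} (μ : Measure (PointMeasure d m)) : Prop :=
  ∃ r : ℝ, 0 < r ∧ ∀ᵐ ν ∂μ, ∀ a : Space d, ν.1 (cube a r ×ˢ Set.univ) ≤ 1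

/-- The weighted counting function `N^w_f(ν) = ν^w(f) = ∑_i w_i ∑_x ν({(x, i)}) f(x)`. -/
def weightedCount {d m : ℕ} (w : Fin m → ℝ) (f : Space d → ℂ) (ν : PointMeasure d m) : ℂ :=
  ∫ p, (w p.2 : ℂ) * f p.1 ∂ν.1

/-- The weighted Palm measure, as a functional on functions of point measures:
`F ↦ ∫ ∑_{x ∈ C} ν^w({x}) F(T_{-x} ν) dμ(ν)`, where `C` is the open cube of edge length `1`
about `0`, whose volume is `1`. -/
def weightedPalm {d m : ℕ} (μ : Measure (PointMeasure d m)) (w : Fin m → ℝ)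
    (F : PointMeasure d m → ℂ) : ℂ :=
  ∫ ν, ∫ p in cube (0 : Space d) 1 ×ˢ Set.univ, (w p.2 : ℂ) * F (-p.1 +ᵥ ν) ∂ν.1 ∂μ

/-- The weighted first moment of the weighted Palm measure (the weighted autocorrelation of the
process), as a functional on functions on `ℝ^d`. -/
def weightedAutocorrelation {d m : ℕ} (μ : Measure (PointMeasure d m)) (w : Fin m → ℝ)
    (f : Space d → ℂ) : ℂ :=
  weightedPalm μ w (weightedCount w f)

/-- `σ` is the Fourier transform of the weighted autocorrelation (the diffraction measure):
its integral against every rapidly decreasing `φ` is the autocorrelation at `𝓕 φ`. -/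
def IsDiffraction {d m : ℕ} (μ : Measure (PointMeasure d m)) (w : Fin m → ℝ)
    (σ : Measure (Space d)) [σ.HasTemperateGrowth] : Prop :=
  ∀ φ : 𝓢(Space d, ℂ), ∫ k, φ k ∂σ = weightedAutocorrelation μ w (𝓕 φ : 𝓢(Space d, ℂ))

/-- The isometric embedding `θ : L²(ℝ^d, σ) → L²(μ)` extends `𝓕 f ↦ N^w_f`, for rapidly
decreasing `f`. -/
def IsDiffractionEmbedding {d m : ℕ} (μ : Measure (PointMeasure d m)) (w : Fin m → ℝ)
    (σ : Measure (Space d)) [σ.HasTemperateGrowth] (θ : Lp ℂ 2 σ →ₗᵢ[ℂ] Lp ℂ 2 μ) : Prop :=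
  ∀ f : 𝓢(Space d, ℂ), θ ((𝓕 f).toLp 2 σ) =ᵐ[μ] weightedCount w f

/-- The unital algebra of functions (under pointwise operations) generated by the image under `θ`
of the Schwartz space. Every representative of an element of the image is a
generator, so that passing to classes modulo null sets gives the algebra of classes generated by
the image; the constant function `1` belongs to it. -/
def generatedAlgebra {d m : ℕ} {μ : Measure (PointMeasure d m)} {σ : Measure (Space d)}
    [σ.HasTemperateGrowth] (θ : Lp ℂ 2 σ →ₗᵢ[ℂ] Lp ℂ 2 μ) :
    Subalgebra ℂ (PointMeasure d m → ℂ) :=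
  Algebra.adjoin ℂ {F | ∃ φ : 𝓢(Space d, ℂ), F =ᵐ[μ] θ (φ.toLp 2 σ)}

end ColouredPointProcess

end

/-!
Uniform discreteness makes every count `N_f` of a rapidly decreasing `f` bounded, so the second
moment `∫ ∑ g(x, y) dμ` over pairs of points is absolutely convergent on suitable `g`, and
stationarity rewrites it as an integral over one unit cell. This identifies `‖N_f‖²` in `L²(μ)` with
the weighted autocorrelation at the Fourier transform of `|𝓕 f|²`. Hence the functional
`φ ↦ autocorrelation (𝓕 φ)` is nonnegative on all `|ψ|²`, so it is integration against a positive
tempered measure `σ` (Bochner–Schwartz), and `𝓕 f ↦ N_f` extends to an isometry of `L²(σ)`.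

For density, the bounded functions in the `L²`-closure of the generated algebra form an algebra
closed under bounded almost everywhere convergence; by Weierstrass approximation it contains the
indicator of every set generated by the null sets and the counts `N_f` of real test functions `f`.
These sets are all the events: if `f` is supported in a cube holding at most one point, then `N_f²`
divided by the count of `f²` is the weight, hence the colour, of the point seen by `f`.
-/

noncomputable section

namespace ColouredPointProcess

open Module Metric ProbabilityTheory
open scoped CompactlySupported ComplexConjugate ComplexOrder ContDiff NNReal Topology

section Decay

variable {E : Type*} [NormedAddCommGroup E]

/-- The weight `(1 + ‖x‖) ^ (-n)`. -/
def decay (n : ℕ) (x : E) : ℝ≥0∞ := ((1 + ‖x‖ₑ) ^ n)⁻¹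

theorem measurable_decay [MeasurableSpace E] [OpensMeasurableSpace E] (n : ℕ) :
    Measurable (decay n : E → ℝ≥0∞) := by
  unfold decay; fun_prop

theorem decay_mul_pow (n : ℕ) (x : E) : decay n x * (1 + ‖x‖ₑ) ^ n = 1 :=
  ENNReal.inv_mul_cancel (by simp) (ENNReal.pow_ne_top (by simp))

theorem decay_add_mul_pow (m n : ℕ) (x : E) : decay (m + n) x * (1 + ‖x‖ₑ) ^ m = decay n x := by
  rw [decay, pow_add, ENNReal.mul_inv (by simp) (by simp), mul_right_comm, ← decay, decay_mul_pow,
    one_mul, decay]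

theorem decay_le_mul_decay (n : ℕ) {x y : E} {δ : ℝ} (h : dist x y ≤ δ) :
    decay n x ≤ (1 + ENNReal.ofReal δ) ^ n * decay n y := by
  have hy : ‖y‖ₑ ≤ ‖x‖ₑ + ENNReal.ofReal δ := by
    calc ‖y‖ₑ = ‖x + (y - x)‖ₑ := by rw [add_sub_cancel]
      _ ≤ ‖x‖ₑ + ‖y - x‖ₑ := enorm_add_le _ _
      _ ≤ _ := by
        gcongr
        rw [← ofReal_norm, ← dist_eq_norm, dist_comm]
        exact ENNReal.ofReal_le_ofReal h
  have hxy : 1 + ‖y‖ₑ ≤ (1 + ENNReal.ofReal δ) * (1 + ‖x‖ₑ) := by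
    calc 1 + ‖y‖ₑ ≤ 1 + (‖x‖ₑ + ENNReal.ofReal δ) := by gcongr
      _ ≤ 1 + (‖x‖ₑ + ENNReal.ofReal δ) + ENNReal.ofReal δ * ‖x‖ₑ := le_self_add
      _ = _ := by ring
  calc decay n x = decay n x * ((1 + ‖y‖ₑ) ^ n * decay n y) := by
        rw [mul_comm _ (decay n y), decay_mul_pow, mul_one]
    _ ≤ decay n x * (((1 + ENNReal.ofReal δ) * (1 + ‖x‖ₑ)) ^ n * decay n y) := by gcongr
    _ = decay n x * (1 + ‖x‖ₑ) ^ n * ((1 + ENNReal.ofReal δ) ^ n * decay n y) := by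
        rw [mul_pow]; ring
    _ = _ := by rw [decay_mul_pow, one_mul]

theorem enorm_rpow_neg_natCast (n : ℕ) (x : E) : ‖(1 + ‖x‖) ^ (-(n : ℝ))‖ₑ = decay n x := by
  rw [Real.rpow_neg (by positivity), Real.rpow_natCast, enorm_inv (by positivity), enorm_pow, decay,
    Real.enorm_of_nonneg (by positivity), ENNReal.ofReal_add zero_le_one (norm_nonneg x),
    ENNReal.ofReal_one, ofReal_norm]

theorem enorm_schwartz_le_mul_decay (𝕜 : Type*) {F : Type*} [NormedField 𝕜] [NormedAddCommGroup F]
    [NormedSpace ℝ E] [NormedSpace ℝ F] [NormedSpace 𝕜 F] [SMulCommClass ℝ 𝕜 F] (n : ℕ)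
    (f : 𝓢(E, F)) (x : E) : ‖f x‖ₑ ≤
      ENNReal.ofReal (2 ^ n * (Finset.Iic (n, 0)).sup (schwartzSeminormFamily 𝕜 E F) f) *
        decay n x := by
  have h := SchwartzMap.one_add_le_sup_seminorm_apply (𝕜 := 𝕜) (m := (n, 0)) le_rfl le_rfl f x
  rw [norm_iteratedFDeriv_zero] at h
  rw [decay, ← div_eq_mul_inv, ENNReal.le_div_iff_mul_le (by simp) (by simp), mul_comm,
    ← ofReal_norm x, ← ENNReal.ofReal_one, ← ENNReal.ofReal_add zero_le_one (norm_nonneg x),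
    ← ENNReal.ofReal_pow (by positivity), ← ofReal_norm (f x),
    ← ENNReal.ofReal_mul (by positivity)]
  exact ENNReal.ofReal_le_ofReal h

theorem one_le_mul_decay (n : ℕ) {x : E} {R : ℝ} (hx : ‖x‖ ≤ R) :
    1 ≤ (1 + ENNReal.ofReal R) ^ n * decay n x := by
  simpa [decay] using decay_le_mul_decay n (x := (0 : E)) (by rwa [dist_zero_left])

theorem hasTemperateGrowth_of_lintegral_decay_lt_top [MeasurableSpace E] [BorelSpace E]
    {ρ : Measure E} {n : ℕ} (h : ∫⁻ x, decay n x ∂ρ < ⊤) : ρ.HasTemperateGrowth := by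
  refine ⟨n, Continuous.aestronglyMeasurable ?_, ?_⟩
  · exact Continuous.rpow_const (by fun_prop) fun x => Or.inl (by positivity)
  · simpa only [HasFiniteIntegral, enorm_rpow_neg_natCast] using h

theorem lintegral_mul_measure_ball_le {X : Type*} [PseudoMetricSpace X] [SecondCountableTopology X]
    [MeasurableSpace X] [OpensMeasurableSpace X] {ρ v : Measure X} [SFinite ρ] [SFinite v]
    {f g : X → ℝ≥0∞} {δ : ℝ} (hf : Measurable f) (hgf : ∀ x y, dist y x < δ → g x ≤ f y) :
    ∫⁻ x, g x * v (ball x δ) ∂ρ ≤ ∫⁻ y, f y * ρ (ball y δ) ∂v := by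
  have hS : MeasurableSet {z : X × X | dist z.2 z.1 < δ} :=
    (isOpen_lt (by fun_prop) (by fun_prop)).measurableSet
  calc ∫⁻ x, g x * v (ball x δ) ∂ρ = ∫⁻ x, ∫⁻ _ in ball x δ, g x ∂v ∂ρ := by
        simp_rw [setLIntegral_const]
    _ ≤ ∫⁻ x, ∫⁻ y in ball x δ, f y ∂v ∂ρ :=
        lintegral_mono fun x => setLIntegral_mono hf fun y => hgf x y
    _ = ∫⁻ x, ∫⁻ y, {z : X × X | dist z.2 z.1 < δ}.indicator (fun z => f z.2) (x, y) ∂v ∂ρ :=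
        lintegral_congr fun x => (lintegral_indicator measurableSet_ball f).symm
    _ = ∫⁻ y, ∫⁻ x, {z : X × X | dist z.2 z.1 < δ}.indicator (fun z => f z.2) (x, y) ∂ρ ∂v :=
        lintegral_lintegral_swap ((hf.comp measurable_snd).indicator hS).aemeasurable
    _ = ∫⁻ y, f y * ρ (ball y δ) ∂v := by
        refine lintegral_congr fun y => ?_
        rw [← setLIntegral_const, ← lintegral_indicator measurableSet_ball]
        refine lintegral_congr fun x => ?_
        simp only [Set.indicator, Set.mem_ofPred_eq, mem_ball, dist_comm]

variable [NormedSpace ℝ E] [FiniteDimensional ℝ E] [MeasurableSpace E] [BorelSpace E]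

theorem lintegral_decay_lt_top (v : Measure E) [v.IsAddHaarMeasure] {n : ℕ}
    (hn : finrank ℝ E < n) : ∫⁻ x, decay n x ∂v < ⊤ := by
  simp_rw [← enorm_rpow_neg_natCast]
  exact (integrable_one_add_norm (by exact_mod_cast hn)).hasFiniteIntegral

-- Averaging over balls compares `ρ` with Lebesgue measure, against which `decay` is integrable.
theorem exists_lintegral_decay_le {δ : ℝ} (hδ : 0 < δ) (c : ℝ≥0) (k : ℕ) {n : ℕ}
    (hn : finrank ℝ E < n) : ∃ C : ℝ≥0, ∀ (ρ : Measure E) [SFinite ρ],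
      (∀ a, ρ (ball a δ) ≤ c * (1 + ‖a‖ₑ) ^ k) → ∫⁻ x, decay (k + n) x ∂ρ ≤ C := by
  let v : Measure E := Measure.addHaar
  have hv₀ : v (ball 0 δ) ≠ 0 := (measure_ball_pos v 0 hδ).ne'
  have hv : v (ball 0 δ) ≠ ⊤ := measure_ball_lt_top.ne
  set K : ℝ≥0∞ := (1 + ENNReal.ofReal δ) ^ (k + n)
  have hC : K * (c * ∫⁻ y, decay n y ∂v) / v (ball 0 δ) ≠ ⊤ := by
    finiteness [(lintegral_decay_lt_top v hn).ne]
  refine ⟨(K * (c * ∫⁻ y, decay n y ∂v) / v (ball 0 δ)).toNNReal, fun ρ _ hρ => ?_⟩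
  rw [ENNReal.coe_toNNReal hC, ENNReal.le_div_iff_mul_le (.inl hv₀) (.inl hv)]
  calc (∫⁻ x, decay (k + n) x ∂ρ) * v (ball 0 δ)
      = ∫⁻ x, decay (k + n) x * v (ball x δ) ∂ρ := by
        simp_rw [Measure.addHaar_ball_center v _ δ]
        rw [lintegral_mul_const _ (measurable_decay _)]
    _ ≤ ∫⁻ y, K * decay (k + n) y * ρ (ball y δ) ∂v :=
        lintegral_mul_measure_ball_le ((measurable_decay _).const_mul K) fun x y hxy =>
          decay_le_mul_decay _ (dist_comm x y ▸ hxy.le)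
    _ ≤ ∫⁻ y, K * (c * decay n y) ∂v := lintegral_mono fun y => by
        calc K * decay (k + n) y * ρ (ball y δ)
            ≤ K * decay (k + n) y * (c * (1 + ‖y‖ₑ) ^ k) := by gcongr; exact hρ y
          _ = K * (c * (decay (k + n) y * (1 + ‖y‖ₑ) ^ k)) := by ring
          _ = _ := by rw [decay_add_mul_pow]
    _ = K * (c * ∫⁻ y, decay n y ∂v) := by
        rw [lintegral_const_mul _ ((measurable_decay n).const_mul _),
          lintegral_const_mul _ (measurable_decay n)]

end Decay

section Cutoff

variable {E F : Type*} [NormedAddCommGroup E] [NormedSpace ℝ E] [NormedAddCommGroup F]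
  [NormedSpace ℝ F]

theorem norm_iteratedFDeriv_comp_smul_le {g : E → F} {j : ℕ} (hg : ContDiff ℝ j g) {ε : ℝ}
    (hε₀ : 0 ≤ ε) (hε₁ : ε ≤ 1) (x : E) :
    ‖iteratedFDeriv ℝ j (fun y => g (ε • y)) x‖ ≤ ‖iteratedFDeriv ℝ j g (ε • x)‖ := by
  rw [iteratedFDeriv_comp_const_smul (f := g) ε hg]
  rw [norm_smul, norm_pow, Real.norm_of_nonneg hε₀]
  exact mul_le_of_le_one_left (norm_nonneg _) (pow_le_one₀ hε₀ hε₁)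

theorem norm_pow_mul_norm_iteratedFDeriv_smul_le {g : E → ℝ} (hg : ContDiff ℝ ∞ g) {R : ℝ}
    (hR : 0 < R) (hgR : ∀ x ∈ ball 0 R, g x = 0) {B : ℕ → ℝ}
    (hB : ∀ j x, ‖iteratedFDeriv ℝ j g x‖ ≤ B j) (φ : 𝓢(E, F)) (k m : ℕ) (x : E) :
    ‖x‖ ^ k * ‖iteratedFDeriv ℝ m (fun y => g y • φ y) x‖ ≤
      (∑ i ∈ Finset.range (m + 1), m.choose i * B i * SchwartzMap.seminorm ℝ (k + 1) (m - i) φ) *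
        R⁻¹ := by
  have hB₀ (j : ℕ) : 0 ≤ B j := (norm_nonneg _).trans (hB j 0)
  by_cases hx : x ∈ ball 0 R
  · have hzero : (fun y => g y • φ y) =ᶠ[𝓝 x] fun _ => 0 := by
      filter_upwards [isOpen_ball.mem_nhds hx] with y hy
      rw [hgR y hy, zero_smul]
    rw [(hzero.iteratedFDeriv ℝ m).eq_of_nhds, iteratedFDeriv_fun_zero, Pi.zero_apply, norm_zero,
      mul_zero]
    exact mul_nonneg (Finset.sum_nonneg fun i _ => by have := hB₀ i; positivity) (by positivity)
  have hRx : R ≤ ‖x‖ := by simpa using hx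
  have hφ (i : ℕ) : ‖x‖ ^ k * ‖iteratedFDeriv ℝ (m - i) φ x‖ ≤
      SchwartzMap.seminorm ℝ (k + 1) (m - i) φ * R⁻¹ := by
    rw [← div_eq_mul_inv, le_div_iff₀ hR]
    calc _ ≤ ‖x‖ ^ k * ‖iteratedFDeriv ℝ (m - i) φ x‖ * ‖x‖ := by gcongr
      _ = ‖x‖ ^ (k + 1) * ‖iteratedFDeriv ℝ (m - i) φ x‖ := by ring
      _ ≤ _ := φ.le_seminorm ℝ _ _ _
  calc ‖x‖ ^ k * ‖iteratedFDeriv ℝ m (fun y => g y • φ y) x‖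
      ≤ ‖x‖ ^ k * ∑ i ∈ Finset.range (m + 1),
          m.choose i * ‖iteratedFDeriv ℝ i g x‖ * ‖iteratedFDeriv ℝ (m - i) φ x‖ := by
        gcongr
        exact norm_iteratedFDeriv_smul_le hg (φ.smooth ⊤) x (mod_cast le_top)
    _ = ∑ i ∈ Finset.range (m + 1), m.choose i * ‖iteratedFDeriv ℝ i g x‖ *
          (‖x‖ ^ k * ‖iteratedFDeriv ℝ (m - i) φ x‖) := by
        rw [Finset.mul_sum]
        exact Finset.sum_congr rfl fun i _ => by ring
    _ ≤ ∑ i ∈ Finset.range (m + 1),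
          m.choose i * B i * (SchwartzMap.seminorm ℝ (k + 1) (m - i) φ * R⁻¹) :=
        Finset.sum_le_sum fun i _ => mul_le_mul (by gcongr; exact hB i x) (hφ i) (by positivity)
          (mul_nonneg (by positivity) (hB₀ i))
    _ = _ := by
        rw [Finset.sum_mul]
        exact Finset.sum_congr rfl fun i _ => by ring

variable [FiniteDimensional ℝ E]

theorem exists_norm_iteratedFDeriv_bump_sub_one_le (χ : ContDiffBump (0 : E)) :
    ∃ B : ℕ → ℝ, ∀ j x, ‖iteratedFDeriv ℝ j (fun y => χ y - 1) x‖ ≤ B j := by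
  let χ' : 𝓢(E, ℝ) := χ.hasCompactSupport.toSchwartzMap χ.contDiff
  refine ⟨fun j => SchwartzMap.seminorm ℝ 0 j χ' + 1, fun j x => ?_⟩
  have hsub : iteratedFDeriv ℝ j (fun y => χ y - 1) x =
      iteratedFDeriv ℝ j χ x - iteratedFDeriv ℝ j (fun _ => (1 : ℝ)) x :=
    iteratedFDeriv_sub_apply χ.contDiffAt contDiffAt_const
  rw [hsub]
  refine (norm_sub_le _ _).trans (add_le_add (χ'.norm_iteratedFDeriv_le_seminorm ℝ j x) ?_)
  rcases eq_or_ne j 0 with rfl | hj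
  · simp
  · simp [iteratedFDeriv_const_of_ne hj]

theorem hasCompactSupport_bump_comp_smul (χ : ContDiffBump (0 : E)) {ε : ℝ} (hε : ε ≠ 0) :
    HasCompactSupport fun x => χ (ε • x) :=
  χ.hasCompactSupport.comp_homeomorph (Homeomorph.smulOfNeZero ε hε)

theorem smulLeftCLM_bump_apply (χ : ContDiffBump (0 : E)) {ε : ℝ} (hε : ε ≠ 0) (φ : 𝓢(E, F))
    (x : E) : SchwartzMap.smulLeftCLM F (fun x => χ (ε • x)) φ x = χ (ε • x) • φ x :=
  SchwartzMap.smulLeftCLM_apply_apply ((hasCompactSupport_bump_comp_smul χ hε).hasTemperateGrowth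
    (χ.contDiff.comp (contDiff_const_smul ε))) φ x

theorem tendsto_smulLeftCLM_bump (χ : ContDiffBump (0 : E)) (φ : 𝓢(E, F)) :
    Tendsto (fun ε : ℝ => SchwartzMap.smulLeftCLM F (fun x => χ (ε • x)) φ) (𝓝[>] 0) (𝓝 φ) := by
  rw [(schwartz_withSeminorms ℝ E F).tendsto_nhds]
  rintro ⟨k, m⟩ η hη
  obtain ⟨B, hB⟩ := exists_norm_iteratedFDeriv_bump_sub_one_le χ
  have hχ : ContDiff ℝ ∞ fun y => χ y - 1 := χ.contDiff.sub contDiff_const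
  set M := ∑ i ∈ Finset.range (m + 1),
    m.choose i * B i * SchwartzMap.seminorm ℝ (k + 1) (m - i) φ
  have hM₀ : 0 ≤ M := Finset.sum_nonneg fun i _ => by
    have := (norm_nonneg _).trans (hB i 0); positivity
  have hlim : Tendsto (fun ε : ℝ => M * (χ.rIn / ε)⁻¹) (𝓝[>] 0) (𝓝 0) := by
    have : Tendsto (fun ε : ℝ => M * (ε / χ.rIn)) (𝓝 0) (𝓝 (M * (0 / χ.rIn))) :=
      (tendsto_id.div_const _).const_mul M
    simpa using this.mono_left nhdsWithin_le_nhds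
  filter_upwards [hlim.eventually (gt_mem_nhds hη), self_mem_nhdsWithin,
    mem_nhdsWithin_of_mem_nhds (gt_mem_nhds one_pos)] with ε hεη (hε₀ : 0 < ε) hε₁
  refine lt_of_le_of_lt (SchwartzMap.seminorm_le_bound ℝ k m _ ?_ fun x => ?_) hεη
  · exact mul_nonneg hM₀ (inv_nonneg.2 (div_nonneg χ.rIn_pos.le hε₀.le))
  have hsub : ⇑(SchwartzMap.smulLeftCLM F (fun x => χ (ε • x)) φ - φ) =
      fun y => (χ (ε • y) - 1) • φ y := by
    ext y
    rw [sub_apply, smulLeftCLM_bump_apply χ hε₀.ne', sub_smul, one_smul]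
  rw [hsub]
  refine norm_pow_mul_norm_iteratedFDeriv_smul_le (hχ.comp (contDiff_const_smul ε))
    (div_pos χ.rIn_pos hε₀) (fun y hy => ?_) (fun j y => ?_) φ k m x
  · rw [Function.comp_apply, χ.one_of_mem_closedBall, sub_self]
    rw [mem_ball_zero_iff, lt_div_iff₀ hε₀, mul_comm] at hy
    rw [mem_closedBall_zero_iff, norm_smul, Real.norm_of_nonneg hε₀.le]
    exact hy.le
  · exact (norm_iteratedFDeriv_comp_smul_le (hχ.of_le (mod_cast le_top)) hε₀.le hε₁.le y).trans
      (hB j _)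

theorem dense_hasCompactSupport : Dense {φ : 𝓢(E, F) | HasCompactSupport φ} := by
  intro φ
  let χ : ContDiffBump (0 : E) := ⟨1, 2, one_pos, one_lt_two⟩
  refine mem_closure_of_tendsto (tendsto_smulLeftCLM_bump χ φ) ?_
  filter_upwards [self_mem_nhdsWithin] with ε (hε : 0 < ε)
  have hmul : ⇑(SchwartzMap.smulLeftCLM F (fun x => χ (ε • x)) φ) = (fun x => χ (ε • x)) • ⇑φ :=
    funext (smulLeftCLM_bump_apply χ hε.ne' φ)
  change HasCompactSupport _
  rw [hmul]
  exact (hasCompactSupport_bump_comp_smul χ hε.ne').smul_right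

end Cutoff

section PositiveDistributions

variable {E F : Type*} [NormedAddCommGroup E] [NormedSpace ℝ E]

section Translation

variable [NormedAddCommGroup F] [NormedSpace ℝ F]

theorem seminorm_compSubConst_le (φ : 𝓢(E, F)) (k n : ℕ) (a : E) :
    SchwartzMap.seminorm ℝ k n (φ.compSubConstCLM ℝ a) ≤
      2 ^ k * (Finset.Iic (k, n)).sup (schwartzSeminormFamily ℝ E F) φ * (1 + ‖a‖) ^ k := by
  refine SchwartzMap.seminorm_le_bound ℝ k n _ (by positivity) fun x => ?_
  have htrans : iteratedFDeriv ℝ n (φ.compSubConstCLM ℝ a) x = iteratedFDeriv ℝ n φ (x - a) :=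
    iteratedFDeriv_comp_sub n a x
  have hx : ‖x‖ ≤ (1 + ‖x - a‖) * (1 + ‖a‖) := by
    nlinarith [norm_le_norm_sub_add x a, norm_nonneg (x - a), norm_nonneg a]
  calc ‖x‖ ^ k * ‖iteratedFDeriv ℝ n (φ.compSubConstCLM ℝ a) x‖
      ≤ ((1 + ‖x - a‖) * (1 + ‖a‖)) ^ k * ‖iteratedFDeriv ℝ n φ (x - a)‖ := by
        rw [htrans]; gcongr
    _ = (1 + ‖x - a‖) ^ k * ‖iteratedFDeriv ℝ n φ (x - a)‖ * (1 + ‖a‖) ^ k := by rw [mul_pow]; ring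
    _ ≤ _ := by
        refine mul_le_mul_of_nonneg_right ?_ (by positivity)
        exact SchwartzMap.one_add_le_sup_seminorm_apply (m := (k, n)) le_rfl le_rfl φ (x - a)

theorem exists_norm_apply_compSubConst_le {G : Type*} [NormedAddCommGroup G] [NormedSpace ℝ G]
    (L : 𝓢(E, F) →L[ℝ] G) (φ : 𝓢(E, F)) :
    ∃ (C : ℝ) (k : ℕ), ∀ a, ‖L (φ.compSubConstCLM ℝ a)‖ ≤ C * (1 + ‖a‖) ^ k := by
  obtain ⟨s, c, -, hc⟩ := Seminorm.bound_of_continuous (schwartz_withSeminorms ℝ E F)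
    ((normSeminorm ℝ G).comp L.toLinearMap) (L.continuous.norm)
  let S (i : ℕ × ℕ) : ℝ := 2 ^ i.1 * (Finset.Iic i).sup (schwartzSeminormFamily ℝ E F) φ
  refine ⟨c * ∑ i ∈ s, S i, s.sup Prod.fst, fun a => ?_⟩
  calc ‖L (φ.compSubConstCLM ℝ a)‖
      ≤ c * s.sup (schwartzSeminormFamily ℝ E F) (φ.compSubConstCLM ℝ a) := hc _
    _ ≤ c * ∑ i ∈ s, SchwartzMap.seminorm ℝ i.1 i.2 (φ.compSubConstCLM ℝ a) := by
        gcongr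
        exact (Seminorm.finset_sup_le_sum _ s _).trans_eq (by
          simp only [← FunLike.coeAddMonoidHom_apply, map_sum, Finset.sum_apply]; rfl)
    _ ≤ c * ∑ i ∈ s, S i * (1 + ‖a‖) ^ s.sup Prod.fst := by
        gcongr with i hi
        refine (seminorm_compSubConst_le φ i.1 i.2 a).trans ?_
        gcongr
        · linarith [norm_nonneg a]
        · exact Finset.le_sup (f := Prod.fst) hi
    _ = _ := by rw [← Finset.sum_mul, mul_assoc]

end Translation

/-- The inclusion of the real-valued into the complex-valued rapidly decreasing functions. -/
def schwartzOfReal : 𝓢(E, ℝ) →L[ℝ] 𝓢(E, ℂ) := SchwartzMap.postcompCLM Complex.ofRealCLM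

theorem schwartzOfReal_apply (f : 𝓢(E, ℝ)) (x : E) : schwartzOfReal f x = f x := rfl

/-- The rapidly decreasing function `x ↦ ‖ψ x‖ ^ 2`. -/
def schwartzNormSq [NormedAddCommGroup F] [InnerProductSpace ℝ F] (ψ : 𝓢(E, F)) : 𝓢(E, ℝ) :=
  SchwartzMap.pairing (𝕜 := ℝ) (innerSL ℝ) ψ ψ

theorem schwartzNormSq_apply [NormedAddCommGroup F] [InnerProductSpace ℝ F] (ψ : 𝓢(E, F)) (x : E) :
    schwartzNormSq ψ x = ‖ψ x‖ ^ 2 :=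
  (SchwartzMap.pairing_apply_apply _ ψ ψ x).trans (real_inner_self_eq_norm_sq _)

theorem contDiff_sqrt_add_mul_sq {f χ : E → ℝ} (hf : ContDiff ℝ ∞ f) (hχ : ContDiff ℝ ∞ χ)
    (hf₀ : ∀ x, 0 ≤ f x) (hχ₀ : ∀ x, 0 ≤ χ x) (hfχ : ∀ x ∈ tsupport f, χ x = 1) {ε : ℝ}
    (hε : 0 < ε) : ContDiff ℝ ∞ fun x => √(f x + ε * χ x ^ 2) := by
  rw [contDiff_iff_contDiffAt]
  intro x
  by_cases hx : x ∈ tsupport f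
  · refine ContDiffAt.sqrt (hf.add (contDiff_const.mul (hχ.pow 2))).contDiffAt ?_
    have := hf₀ x
    rw [hfχ x hx]
    positivity
  · have heq : (fun x => √(f x + ε * χ x ^ 2)) =ᶠ[𝓝 x] fun y => √ε * χ y := by
      filter_upwards [notMem_tsupport_iff_eventuallyEq.1 hx] with y hy
      rw [hy, Pi.zero_apply, zero_add, Real.sqrt_mul hε.le, Real.sqrt_sq (hχ₀ y)]
    exact (contDiff_const.mul hχ).contDiffAt.congr_of_eventuallyEq heq

variable [FiniteDimensional ℝ E]

theorem exists_bump_eq_one {K : Set E} (hK : IsCompact K) :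
    ∃ χ : ContDiffBump (0 : E), ∀ x ∈ K, χ x = 1 := by
  obtain ⟨R, hR⟩ := hK.isBounded.subset_closedBall (0 : E)
  refine ⟨⟨max R 1, max R 1 + 1, by positivity, by linarith⟩, fun x hx => ?_⟩
  exact ContDiffBump.one_of_mem_closedBall _
    (closedBall_subset_closedBall (le_max_left _ _) (hR hx))

/-- A bump function as a rapidly decreasing function. -/
def schwartzBump {c : E} (χ : ContDiffBump c) : 𝓢(E, ℝ) :=
  χ.hasCompactSupport.toSchwartzMap χ.contDiff

theorem schwartzBump_apply {c : E} (χ : ContDiffBump c) (x : E) : schwartzBump χ x = χ x := rfl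

-- `f + ε χ²` is the square of a smooth function, although `f` itself need not be; let `ε → 0`.
theorem nonneg_of_nonneg_on_normSq {L : 𝓢(E, ℝ) →ₗ[ℝ] ℝ}
    (hL : ∀ ψ : 𝓢(E, ℝ), 0 ≤ L (schwartzNormSq ψ)) {f : 𝓢(E, ℝ)} (hc : HasCompactSupport f)
    (hf : ∀ x, 0 ≤ f x) : 0 ≤ L f := by
  obtain ⟨χ, hχ⟩ := exists_bump_eq_one hc.isCompact
  have key (ε : ℝ) (hε : 0 < ε) : 0 ≤ L f + ε * L (schwartzNormSq (schwartzBump χ)) := by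
    have hroot_smooth : ContDiff ℝ ∞ fun x => √(f x + ε * χ x ^ 2) :=
      contDiff_sqrt_add_mul_sq (f.smooth ⊤) χ.contDiff hf (fun _ => χ.nonneg) hχ hε
    have hroot_supp : HasCompactSupport fun x => √(f x + ε * χ x ^ 2) := by
      refine (hc.add (χ.hasCompactSupport.comp_left (g := fun t => ε * t ^ 2) (by simp))).comp_left
        (g := Real.sqrt) Real.sqrt_zero
    have hsq : schwartzNormSq (hroot_supp.toSchwartzMap hroot_smooth) =
        f + ε • schwartzNormSq (schwartzBump χ) := by
      ext x
      have hx : 0 ≤ f x + ε * χ x ^ 2 := by have := hf x; positivity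
      simp only [schwartzNormSq_apply, HasCompactSupport.toSchwartzMap_toFun, Real.norm_eq_abs,
        sq_abs, Real.sq_sqrt hx, add_apply, smul_apply, smul_eq_mul, schwartzBump_apply]
    simpa only [hsq, map_add, map_smul, smul_eq_mul] using
      hL (hroot_supp.toSchwartzMap hroot_smooth)
  have hlim : Tendsto (fun ε : ℝ => L f + ε * L (schwartzNormSq (schwartzBump χ))) (𝓝[>] 0)
      (𝓝 (L f + 0 * L (schwartzNormSq (schwartzBump χ)))) :=
    ((tendsto_id.mul_const _).const_add _).mono_left nhdsWithin_le_nhds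
  rw [zero_mul, add_zero] at hlim
  exact ge_of_tendsto hlim (by filter_upwards [self_mem_nhdsWithin] with ε hε using key ε hε)

/-- The subspace of smooth functions in `C_c(E, ℝ)`. -/
def smoothCompactlySupported (E : Type*) [NormedAddCommGroup E] [NormedSpace ℝ E] :
    Submodule ℝ C_c(E, ℝ) where
  carrier := {f | ContDiff ℝ ∞ f}
  add_mem' {f g} hf hg := show ContDiff ℝ ∞ fun x => f x + g x from ContDiff.add hf hg
  zero_mem' := show ContDiff ℝ ∞ fun _ => (0 : ℝ) from contDiff_const
  smul_mem' c f hf := show ContDiff ℝ ∞ fun x => c • f x from ContDiff.const_smul c hf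

/-- Smooth compactly supported functions as rapidly decreasing functions. -/
def smoothCompactlySupported.toSchwartz : smoothCompactlySupported E →ₗ[ℝ] 𝓢(E, ℝ) where
  toFun f := f.1.hasCompactSupport.toSchwartzMap f.2
  map_add' _ _ := rfl
  map_smul' _ _ := rfl

theorem exists_smoothCompactlySupported_nonneg_add (f : C_c(E, ℝ)) :
    ∃ g : smoothCompactlySupported E, ∀ x, 0 ≤ g.1 x + f x := by
  obtain ⟨χ, hχ⟩ := exists_bump_eq_one f.hasCompactSupport.isCompact
  obtain ⟨M, hM⟩ := f.hasCompactSupport.exists_bound_of_continuous f.continuous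
  refine ⟨⟨⟨⟨fun x => M * χ x, continuous_const.mul χ.continuous⟩, χ.hasCompactSupport.mul_left⟩,
    contDiff_const.mul χ.contDiff⟩, fun x => ?_⟩
  change 0 ≤ M * χ x + f x
  by_cases hx : x ∈ tsupport f
  · rw [hχ x hx, mul_one]
    linarith [neg_abs_le (f x), hM x, Real.norm_eq_abs (f x)]
  · rw [image_eq_zero_of_notMem_tsupport hx, add_zero]
    exact mul_nonneg ((norm_nonneg _).trans (hM 0)) χ.nonneg

theorem eq_zero_of_eq_zero_on_normSq {L : 𝓢(E, ℝ) →L[ℝ] ℝ}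
    (hL : ∀ ψ : 𝓢(E, ℝ), L (schwartzNormSq ψ) = 0) : L = 0 := by
  refine DFunLike.coe_injective (L.continuous.ext_on dense_hasCompactSupport continuous_const
    fun f (hf : HasCompactSupport f) => ?_)
  obtain ⟨χ, hχ⟩ := exists_bump_eq_one hf.isCompact
  have hpolar : (4 : ℝ) • f = schwartzNormSq (f + schwartzBump χ) -
      schwartzNormSq (f - schwartzBump χ) := by
    ext x
    simp only [smul_apply, smul_eq_mul, sub_apply, schwartzNormSq_apply, add_apply,
      schwartzBump_apply, Real.norm_eq_abs, sq_abs]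
    by_cases hx : x ∈ tsupport f
    · rw [hχ x hx]; ring
    · rw [image_eq_zero_of_notMem_tsupport hx]; ring
  have h4 := congr_arg L hpolar
  rw [map_smul, map_sub, hL, hL, sub_zero] at h4
  simpa using h4

variable [MeasurableSpace E] [BorelSpace E]

theorem exists_measure_of_nonneg_on_compactlySupported {L : 𝓢(E, ℝ) →ₗ[ℝ] ℝ}
    (hL : ∀ f : 𝓢(E, ℝ), HasCompactSupport f → (∀ x, 0 ≤ f x) → 0 ≤ L f) :
    ∃ σ : Measure E, IsFiniteMeasureOnCompacts σ ∧
      ∀ f : 𝓢(E, ℝ), HasCompactSupport f → ∫ x, f x ∂σ = L f := by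
  let s : PointedCone ℝ C_c(E, ℝ) :=
    { carrier := {f | ∀ x, 0 ≤ f x}
      add_mem' := fun hf hg x => add_nonneg (hf x) (hg x)
      zero_mem' := fun _ => le_rfl
      smul_mem' := fun c f hf x => mul_nonneg c.2 (hf x) }
  obtain ⟨Λ, hΛ, hΛ₀⟩ := riesz_extension s
    ⟨smoothCompactlySupported E, L ∘ₗ smoothCompactlySupported.toSchwartz⟩
    (fun f hf => hL _ f.1.hasCompactSupport hf) exists_smoothCompactlySupported_nonneg_add
  let Λ' : C_c(E, ℝ) →ₚ[ℝ] ℝ := PositiveLinearMap.mk₀ Λ fun f hf => hΛ₀ f hf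
  refine ⟨RealRMK.rieszMeasure Λ', inferInstance, fun f hc => ?_⟩
  exact (RealRMK.integral_rieszMeasure Λ' ⟨⟨f, f.continuous⟩, hc⟩).trans
    (hΛ ⟨⟨⟨f, f.continuous⟩, hc⟩, f.smooth ⊤⟩)

theorem exists_measure_ball_le {L : 𝓢(E, ℝ) →L[ℝ] ℝ} {σ : Measure E} [IsFiniteMeasureOnCompacts σ]
    (hσ : ∀ f : 𝓢(E, ℝ), HasCompactSupport f → ∫ x, f x ∂σ = L f) :
    ∃ (c : ℝ≥0) (k : ℕ), ∀ a, σ (ball a 1) ≤ c * (1 + ‖a‖ₑ) ^ k := by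
  let χ : ContDiffBump (0 : E) := ⟨1, 2, one_pos, one_lt_two⟩
  obtain ⟨C, k, hC⟩ := exists_norm_apply_compSubConst_le L (schwartzBump χ)
  refine ⟨C.toNNReal, k, fun a => ?_⟩
  set f := (schwartzBump χ).compSubConstCLM ℝ a
  have hfχ (x : E) : f x = χ (x - a) := rfl
  have hc : HasCompactSupport f := χ.hasCompactSupport.comp_homeomorph (Homeomorph.subRight a)
  calc σ (ball a 1) = ∫⁻ _ in ball a 1, 1 ∂σ := (setLIntegral_one _).symm
    _ ≤ ∫⁻ x in ball a 1, ENNReal.ofReal (f x) ∂σ := by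
        refine setLIntegral_mono' measurableSet_ball fun x hx => ?_
        rw [hfχ, χ.one_of_mem_closedBall, ENNReal.ofReal_one]
        rw [mem_closedBall_zero_iff, ← dist_eq_norm]
        exact (mem_ball.1 hx).le
    _ ≤ ∫⁻ x, ENNReal.ofReal (f x) ∂σ := setLIntegral_le_lintegral _ _
    _ = ENNReal.ofReal (∫ x, f x ∂σ) :=
        (ofReal_integral_eq_lintegral_ofReal (f.continuous.integrable_of_hasCompactSupport hc)
          (ae_of_all _ fun x => χ.nonneg)).symm
    _ ≤ ENNReal.ofReal (C * (1 + ‖a‖) ^ k) := by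
        rw [hσ f hc]
        exact ENNReal.ofReal_le_ofReal ((Real.le_norm_self _).trans (hC a))
    _ = _ := by
        rw [ENNReal.ofReal_mul' (by positivity), ENNReal.ofReal_pow (by positivity),
          ENNReal.ofReal_add zero_le_one (norm_nonneg a), ENNReal.ofReal_one, ofReal_norm,
          ENNReal.ofReal]

theorem exists_measure_of_nonneg_on_real_normSq {L : 𝓢(E, ℝ) →L[ℝ] ℝ}
    (hL : ∀ ψ : 𝓢(E, ℝ), 0 ≤ L (schwartzNormSq ψ)) :
    ∃ (σ : Measure E) (_ : σ.HasTemperateGrowth), IsFiniteMeasureOnCompacts σ ∧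
      ∀ φ : 𝓢(E, ℝ), ∫ x, φ x ∂σ = L φ := by
  obtain ⟨σ, hfin, hσ⟩ := exists_measure_of_nonneg_on_compactlySupported (L := L.toLinearMap)
    fun f => nonneg_of_nonneg_on_normSq hL
  obtain ⟨c, k, hck⟩ := exists_measure_ball_le hσ
  obtain ⟨C, hC⟩ := exists_lintegral_decay_le (E := E) one_pos c k (Nat.lt_succ_self _)
  have htg : σ.HasTemperateGrowth :=
    hasTemperateGrowth_of_lintegral_decay_lt_top ((hC σ hck).trans_lt ENNReal.coe_lt_top)
  refine ⟨σ, htg, hfin, fun φ => ?_⟩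
  rw [← SchwartzMap.integralCLM_apply ℝ]
  refine congr_fun ((SchwartzMap.integralCLM ℝ σ).continuous.ext_on dense_hasCompactSupport
    L.continuous fun f hf => ?_) φ
  rw [SchwartzMap.integralCLM_apply]
  exact hσ f hf

/-- The **Bochner–Schwartz theorem**, with `T` in the role of the Fourier transform of a positive
definite distribution. -/
theorem exists_measure_of_nonneg_on_normSq {T : 𝓢(E, ℂ) →L[ℂ] ℂ}
    (hT : ∀ ψ : 𝓢(E, ℂ), 0 ≤ T (schwartzOfReal (schwartzNormSq ψ))) :
    ∃ (σ : Measure E) (_ : σ.HasTemperateGrowth), IsFiniteMeasureOnCompacts σ ∧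
      ∀ φ : 𝓢(E, ℂ), ∫ x, φ x ∂σ = T φ := by
  let Tr : 𝓢(E, ℝ) →L[ℝ] ℂ := T.restrictScalars ℝ ∘L schwartzOfReal
  have hnonneg (ψ : 𝓢(E, ℝ)) : 0 ≤ Tr (schwartzNormSq ψ) := by
    have hψ : schwartzNormSq (schwartzOfReal ψ) = schwartzNormSq ψ := by
      ext x
      simp only [schwartzNormSq_apply, schwartzOfReal_apply, Complex.norm_real]
    exact hψ ▸ hT (schwartzOfReal ψ)
  obtain ⟨σ, htg, hfin, hσ⟩ := exists_measure_of_nonneg_on_real_normSq (L := Complex.reCLM ∘L Tr)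
    fun ψ => (Complex.nonneg_iff.1 (hnonneg ψ)).1
  have him : Complex.imCLM ∘L Tr = 0 :=
    eq_zero_of_eq_zero_on_normSq fun ψ => (Complex.nonneg_iff.1 (hnonneg ψ)).2.symm
  have hreal (f : 𝓢(E, ℝ)) : T (schwartzOfReal f) = ∫ x, f x ∂σ := by
    refine Complex.ext ?_ (DFunLike.congr_fun him f)
    exact (hσ f).symm
  refine ⟨σ, htg, hfin, fun φ => ?_⟩
  have hφ : φ = schwartzOfReal (φ.postcompCLM Complex.reCLM) +
      Complex.I • schwartzOfReal (φ.postcompCLM Complex.imCLM) := by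
    ext x
    exact (Complex.re_add_im (φ x)).symm.trans (by rw [mul_comm]; rfl)
  rw [← SchwartzMap.integralCLM_apply ℂ, hφ]
  simp only [map_add, map_smul, hreal, SchwartzMap.integralCLM_apply, schwartzOfReal_apply,
    integral_complex_ofReal]

end PositiveDistributions

section SFiniteKernel

variable {α β : Type*} [MeasurableSpace α] [MeasurableSpace β]

theorem isSFiniteKernel_of_lt_top {κ : Kernel α β} (hκ : ∀ a, κ a Set.univ < ⊤) :
    IsSFiniteKernel κ := by
  classical
  have hmeas (n : ℕ) : MeasurableSet {a | ⌊(κ a Set.univ).toReal⌋₊ = n} :=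
    (κ.measurable_coe .univ).ennreal_toReal.nat_floor (measurableSet_singleton n)
  refine ⟨⟨fun n => Kernel.piecewise (hmeas n) κ 0, fun n => ⟨n + 1, by finiteness, fun a => ?_⟩,
    ?_⟩⟩
  · rw [Kernel.piecewise_apply']
    split_ifs with ha
    · rw [← ENNReal.toReal_le_toReal (hκ a).ne (by finiteness), ← ha.out,
        ENNReal.toReal_add (by finiteness) (by finiteness)]
      simpa using (Nat.lt_floor_add_one (κ a Set.univ).toReal).le
    · simp
  · ext a s hs
    rw [Kernel.sum_apply' _ _ hs, tsum_eq_single ⌊(κ a Set.univ).toReal⌋₊]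
    · simp [Kernel.piecewise_apply']
    · exact fun n hn => by simp [Kernel.piecewise_apply', hn.symm]

theorem isSFiniteKernel_of_iUnion {κ : Kernel α β} {B : ℕ → Set β}
    (hB : ∀ n, MeasurableSet (B n)) (hU : ⋃ n, B n = Set.univ) (hκ : ∀ n a, κ a (B n) < ⊤) :
    IsSFiniteKernel κ := by
  have hD (n : ℕ) : MeasurableSet (disjointed B n) := .disjointed hB n
  have (n : ℕ) : IsSFiniteKernel (κ.restrict (hD n)) := isSFiniteKernel_of_lt_top fun a => by
    rw [Kernel.restrict_apply, Measure.restrict_apply_univ]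
    exact (measure_mono (disjointed_subset B n)).trans_lt (hκ n a)
  have hsum : κ = Kernel.sum fun n => κ.restrict (hD n) := by
    ext a s
    rw [Kernel.sum_apply]
    simp_rw [Kernel.restrict_apply]
    rw [← Measure.restrict_iUnion (disjoint_disjointed B) hD, iUnion_disjointed, hU,
      Measure.restrict_univ]
  rw [hsum]
  infer_instance

end SFiniteKernel

section Cube

variable {d : ℕ} (a : Space d) (R : ℝ)

theorem cube_eq_preimage_pi :
    cube a R = WithLp.ofLp ⁻¹' Set.univ.pi fun i => ball (a i) (R / 2) := by
  ext x
  simp [cube, Real.dist_eq]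

theorem isOpen_cube : IsOpen (cube a R) := by
  rw [cube_eq_preimage_pi]
  exact (isOpen_set_pi Set.finite_univ fun _ _ => isOpen_ball).preimage (PiLp.continuous_ofLp 2 _)

theorem isBounded_cube : Bornology.IsBounded (cube a R) := by
  rw [cube_eq_preimage_pi]
  exact (PiLp.antilipschitzWith_ofLp 2 _).isBounded_preimage (.pi fun _ => isBounded_ball)

theorem volume_cube_one : volume (cube a 1) = 1 := by
  rw [cube_eq_preimage_pi, (PiLp.volume_preserving_ofLp (Fin d)).measure_preimage
    (MeasurableSet.univ_pi fun _ => measurableSet_ball).nullMeasurableSet, volume_pi_pi]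
  simp

theorem ball_subset_cube : ball a (R / 2) ⊆ cube a R := fun x hx i => by
  rw [← Real.norm_eq_abs, ← PiLp.sub_apply]
  exact (PiLp.norm_apply_le (x - a) i).trans_lt (mem_ball_iff_norm.1 hx)

end Cube

section PointMeasures

variable {d m : ℕ} {C : ℝ≥0} {ν : PointMeasure d m}

instance (ν : PointMeasure d m) : IsFiniteMeasureOnCompacts ν.1 where
  lt_top_of_isCompact K hK := by
    obtain ⟨n, hn⟩ := ν.2 K hK.isClosed.measurableSet (by rwa [hK.isClosed.closure_eq])
    rw [hn]
    exact ENNReal.natCast_lt_top n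

/-- The tautological kernel, by which a random point measure is treated as a random measure. -/
def pointKernel (d m : ℕ) : Kernel (PointMeasure d m) (Space d × Fin m) :=
  ⟨Subtype.val, measurable_subtype_coe⟩

theorem pointKernel_apply (ν : PointMeasure d m) : pointKernel d m ν = ν.1 := rfl

instance : IsSFiniteKernel (pointKernel d m) :=
  isSFiniteKernel_of_iUnion (fun n => (isCompact_compactCovering _ n).isClosed.measurableSet)
    (iUnion_compactCovering _) fun n ν =>
      (isCompact_compactCovering _ n).measure_lt_top (μ := ν.1)

theorem vadd_val (t : Space d) (ν : PointMeasure d m) : (t +ᵥ ν).1 = ν.1.map (shift m t) := rfl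

theorem measurable_vadd (t : Space d) : Measurable fun ν : PointMeasure d m => t +ᵥ ν :=
  ((Measure.measurable_map _ (shift m t).continuous.measurable).comp
    measurable_subtype_coe).subtype_mk

/-- The quantitative form in which uniform discreteness is used: all the translates of `decay`
have integral at most `C`. -/
def DecayBounded (C : ℝ≥0) (ν : PointMeasure d m) : Prop :=
  ∀ a, ∫⁻ p, decay (d + 1) (p.1 - a) ∂ν.1 ≤ C

theorem IsUniformlyDiscrete.exists_decayBounded {μ : Measure (PointMeasure d m)}
    (hμ : IsUniformlyDiscrete μ) : ∃ C : ℝ≥0, ∀ᵐ ν ∂μ, DecayBounded C ν := by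
  obtain ⟨r, hr, hμ⟩ := hμ
  obtain ⟨C, hC⟩ :=
    exists_lintegral_decay_le (E := Space d) (half_pos hr) 1 0 (n := d + 1) (by simp)
  refine ⟨C, hμ.mono fun ν hν a => ?_⟩
  have hsub : Measurable fun p : Space d × Fin m => p.1 - a := by fun_prop
  rw [← lintegral_map (measurable_decay _) hsub, ← zero_add (d + 1)]
  refine hC _ fun b => ?_
  rw [Measure.map_apply hsub measurableSet_ball, pow_zero, mul_one, ENNReal.coe_one]
  refine (measure_mono fun p hp => ?_).trans (hν (a + b))
  refine ⟨ball_subset_cube (a + b) r ?_, trivial⟩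
  rw [mem_ball_iff_norm, ← sub_sub]
  exact mem_ball_iff_norm.1 hp

theorem enorm_weight_le (w : Fin m → ℝ) (i : Fin m) : ‖(w i : ℂ)‖ₑ ≤ ‖w‖ₑ := by
  simpa only [enorm, Complex.nnnorm_real] using ENNReal.coe_le_coe.2 (nnnorm_le_pi_nnnorm w i)

theorem measurable_weight_mul (w : Fin m → ℝ) {g : Space d → ℂ} (hg : Measurable g) :
    Measurable fun p : Space d × Fin m => (w p.2 : ℂ) * g p.1 :=
  ((measurable_of_finite fun i => (w i : ℂ)).comp measurable_snd).mul (hg.comp measurable_fst)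

theorem stronglyMeasurable_weightedCount (w : Fin m → ℝ) {g : Space d → ℂ} (hg : Measurable g) :
    StronglyMeasurable (weightedCount w g : PointMeasure d m → ℂ) :=
  .integral_kernel (κ := pointKernel d m) (measurable_weight_mul w hg).stronglyMeasurable

theorem DecayBounded.lintegral_weight_mul_le (hν : DecayBounded C ν) (w : Fin m → ℝ)
    {g : Space d → ℂ} {S : ℝ≥0∞} (hg : ∀ x, ‖g x‖ₑ ≤ S * decay (d + 1) x) :
    ∫⁻ p, ‖(w p.2 : ℂ) * g p.1‖ₑ ∂ν.1 ≤ ‖w‖ₑ * S * C := by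
  calc ∫⁻ p, ‖(w p.2 : ℂ) * g p.1‖ₑ ∂ν.1
      ≤ ∫⁻ p, ‖w‖ₑ * S * decay (d + 1) (p.1 - 0) ∂ν.1 := lintegral_mono fun p => by
        rw [enorm_mul, sub_zero, mul_assoc]
        gcongr
        exacts [enorm_weight_le w p.2, hg p.1]
    _ = ‖w‖ₑ * S * ∫⁻ p, decay (d + 1) (p.1 - 0) ∂ν.1 :=
        lintegral_const_mul _ ((measurable_decay _).comp (by fun_prop))
    _ ≤ ‖w‖ₑ * S * C := by gcongr; exact hν 0

theorem DecayBounded.integrable_weight_mul (hν : DecayBounded C ν) (w : Fin m → ℝ)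
    (f : 𝓢(Space d, ℂ)) : Integrable (fun p : Space d × Fin m => (w p.2 : ℂ) * f p.1) ν.1 :=
  ⟨(measurable_weight_mul w f.continuous.measurable).aestronglyMeasurable,
    (hν.lintegral_weight_mul_le w (enorm_schwartz_le_mul_decay ℂ _ f)).trans_lt (by finiteness)⟩

theorem memLp_top_weightedCount {μ : Measure (PointMeasure d m)} (hC : ∀ᵐ ν ∂μ, DecayBounded C ν)
    (w : Fin m → ℝ) (f : 𝓢(Space d, ℂ)) : MemLp (weightedCount w f) ∞ μ := by
  have hbound := hC.mono fun ν hν => (enorm_integral_le_lintegral_enorm _).trans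
    (hν.lintegral_weight_mul_le w (enorm_schwartz_le_mul_decay ℂ _ f))
  refine ⟨(stronglyMeasurable_weightedCount w f.continuous.measurable).aestronglyMeasurable, ?_⟩
  rw [eLpNorm_exponent_top]
  exact (essSup_le_of_ae_le _ hbound).trans_lt (by finiteness)

end PointMeasures

section Correlation

theorem integral_eq_integral_preimage_integral {V Z F : Type*} [AddCommGroup V]
    [MeasurableSpace V] [MeasurableAdd₂ V] [MeasurableNeg V] [MeasurableSpace Z]
    [NormedAddCommGroup F] [NormedSpace ℝ F] {v : Measure V} [SFinite v] [v.IsAddLeftInvariant]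
    [v.IsNegInvariant] {M : Measure Z} [SFinite M] {s : V → Z → Z}
    (hs : Measurable (Function.uncurry s)) (hM : ∀ t, M.map (s t) = M) {π : Z → V}
    (hπ : Measurable π) (hπs : ∀ t z, π (s t z) = t + π z) {S : Set V} (hS : MeasurableSet S)
    (hvS : v S ≠ ⊤) {Φ : Z → F} (hΦ : Integrable Φ M) :
    v.real S • ∫ z, Φ z ∂M = ∫ z in π ⁻¹' S, ∫ t, Φ (s t z) ∂v ∂M := by
  have hshift : MeasurePreserving (fun p : V × Z => (p.1, s p.1 p.2)) (v.prod M) (v.prod M) :=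
    (MeasurePreserving.id v).skew_product hs (ae_of_all _ hM)
  have hreflect : MeasurePreserving (fun p : Z × V => (p.1, π p.1 - p.2)) (M.prod v) (M.prod v) :=
    (MeasurePreserving.id M).skew_product (g := fun z t => π z - t)
      ((hπ.comp measurable_fst).sub measurable_snd)
      (ae_of_all _ fun z => (Measure.measurePreserving_sub_left v (π z)).map_eq)
  have hΨ : MeasurePreserving (fun p : V × Z => (π p.2, s p.1 p.2)) (v.prod M) (v.prod M) := by
    convert (Measure.measurePreserving_swap.comp hreflect).comp
      (Measure.measurePreserving_swap.comp hshift) using 2 with p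
    simp [hπs]
  have hind : Integrable (S.indicator (1 : V → ℝ)) v :=
    (integrable_indicator_iff hS).2 (integrableOn_const hvS)
  have hint : Integrable (fun p : V × Z => S.indicator (1 : V → ℝ) p.1 • Φ p.2) (v.prod M) :=
    hind.smul_prod hΦ
  calc v.real S • ∫ z, Φ z ∂M = ∫ p, S.indicator (1 : V → ℝ) p.1 • Φ p.2 ∂v.prod M := by
        rw [integral_prod_smul, integral_indicator_one hS]
    _ = ∫ p, S.indicator (1 : V → ℝ) (π p.2) • Φ (s p.1 p.2) ∂v.prod M := by
        conv_lhs => rw [← hΨ.map_eq]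
        exact integral_map hΨ.aemeasurable (by rw [hΨ.map_eq]; exact hint.aestronglyMeasurable)
    _ = ∫ z, ∫ t, S.indicator (1 : V → ℝ) (π z) • Φ (s t z) ∂v ∂M :=
        integral_prod_symm _ (hΨ.integrable_comp_of_integrable hint)
    _ = ∫ z in π ⁻¹' S, ∫ t, Φ (s t z) ∂v ∂M := by
        rw [← integral_indicator (hπ hS)]
        refine integral_congr_ae (ae_of_all _ fun z => ?_)
        by_cases hz : π z ∈ S <;> simp [hz]

variable {V : Type*} [NormedAddCommGroup V] [InnerProductSpace ℝ V] [FiniteDimensional ℝ V]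
  [MeasurableSpace V] [BorelSpace V]

theorem fourier_compSubConst (h : 𝓢(V, ℂ)) (a k : V) :
    𝓕 (SchwartzMap.compSubConstCLM ℂ a h) k = Real.fourierChar (-inner ℝ a k) • 𝓕 h k := by
  have := congr_fun (VectorFourier.fourierIntegral_comp_add_right Real.fourierChar
    (volume : Measure V) (innerₗ V) h (-a)) k
  simpa [SchwartzMap.fourier_coe, Real.fourier_eq, VectorFourier.fourierIntegral,
    sub_eq_add_neg] using this

theorem integral_mul_conj_translate (h : 𝓢(V, ℂ)) (x y : V) :
    ∫ t, h (t + x) * conj (h (t + y)) = 𝓕 (schwartzOfReal (schwartzNormSq (𝓕 h))) (y - x) := by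
  have hchar (k : V) : (Real.fourierChar (-inner ℝ k (y - x)) : ℂ) =
      Real.fourierChar (-inner ℝ (-x) k) * conj (Real.fourierChar (-inner ℝ (-y) k) : ℂ) := by
    rw [← Circle.coe_inv_eq_conj, ← AddChar.map_neg_eq_inv, ← Circle.coe_mul,
      ← AddChar.map_add_eq_mul]
    congr 3
    rw [inner_sub_right, real_inner_comm x k, real_inner_comm y k, inner_neg_left, inner_neg_left]
    ring
  calc ∫ t, h (t + x) * conj (h (t + y))
      = ∫ t, inner ℂ (SchwartzMap.compSubConstCLM ℂ (-y) h t)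
          (SchwartzMap.compSubConstCLM ℂ (-x) h t) := by
        simp [RCLike.inner_apply]
    _ = ∫ k, inner ℂ (𝓕 (SchwartzMap.compSubConstCLM ℂ (-y) h) k)
          (𝓕 (SchwartzMap.compSubConstCLM ℂ (-x) h) k) :=
        (SchwartzMap.integral_inner_fourier_fourier _ _).symm
    _ = ∫ k, Real.fourierChar (-inner ℝ k (y - x)) • schwartzOfReal (schwartzNormSq (𝓕 h)) k := by
        refine integral_congr_ae (ae_of_all _ fun k => ?_)
        simp only [fourier_compSubConst, RCLike.inner_apply, schwartzOfReal_apply,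
          schwartzNormSq_apply, Circle.smul_def, smul_eq_mul, map_mul, hchar]
        rw [← Complex.normSq_eq_norm_sq, ← Complex.mul_conj]
        ring
    _ = 𝓕 (schwartzOfReal (schwartzNormSq (𝓕 h))) (y - x) := by
        rw [SchwartzMap.fourier_coe, Real.fourier_eq]

end Correlation

section SecondMoment

variable {d m : ℕ} {μ : Measure (PointMeasure d m)} {C : ℝ≥0}

/-- The (reducible) second moment measure of the point process with law `μ`. -/
def secondMoment (μ : Measure (PointMeasure d m)) :
    Measure ((Space d × Fin m) × (Space d × Fin m)) :=
  μ.bind (pointKernel d m ×ₖ pointKernel d m)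

instance [SFinite μ] : SFinite (secondMoment μ) := by
  unfold secondMoment; infer_instance

theorem lintegral_secondMoment (μ : Measure (PointMeasure d m))
    {Φ : (Space d × Fin m) × (Space d × Fin m) → ℝ≥0∞} (hΦ : Measurable Φ) :
    ∫⁻ z, Φ z ∂secondMoment μ = ∫⁻ ν, ∫⁻ p, ∫⁻ q, Φ (p, q) ∂ν.1 ∂ν.1 ∂μ := by
  rw [secondMoment, Measure.lintegral_bind (Kernel.aemeasurable _) hΦ.aemeasurable]
  refine lintegral_congr fun ν => ?_
  rw [Kernel.prod_apply, lintegral_prod _ hΦ.aemeasurable]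
  rfl

theorem integral_secondMoment [SFinite μ] {F : Type*} [NormedAddCommGroup F] [NormedSpace ℝ F]
    {Φ : (Space d × Fin m) × (Space d × Fin m) → F} (hΦ : Integrable Φ (secondMoment μ)) :
    ∫ z, Φ z ∂secondMoment μ = ∫ ν, ∫ p, ∫ q, Φ (p, q) ∂ν.1 ∂ν.1 ∂μ := by
  have h := Measure.ae_integrable_of_integrable_comp hΦ
  rw [secondMoment, Measure.comp_eq_comp_const_apply] at hΦ ⊢
  rw [Kernel.integral_comp hΦ, Kernel.const_apply]
  refine integral_congr_ae (h.mono fun ν hν => ?_)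
  simp only [Kernel.prod_apply] at hν ⊢
  exact integral_prod _ hν

theorem map_shift_secondMoment [VAddInvariantMeasure (Space d) (PointMeasure d m) μ]
    (t : Space d) : (secondMoment μ).map (Prod.map (shift m t) (shift m t)) = secondMoment μ := by
  have hs : Measurable (shift m t) := (shift m t).continuous.measurable
  have hss : Measurable (Prod.map (shift m t) (shift m t)) := hs.prodMap hs
  have hμ : μ.map (t +ᵥ ·) = μ := by
    ext A hA
    rw [Measure.map_apply (measurable_vadd t) hA]
    exact VAddInvariantMeasure.measure_preimage_vadd t hA
  ext S hS
  rw [Measure.map_apply hss hS, secondMoment, Measure.bind_apply (hss hS) (Kernel.aemeasurable _),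
    Measure.bind_apply hS (Kernel.aemeasurable _)]
  conv_rhs => rw [← hμ, lintegral_map (Kernel.measurable_coe _ hS) (measurable_vadd t)]
  refine lintegral_congr fun ν => ?_
  rw [Kernel.prod_apply, Kernel.prod_apply, pointKernel_apply, pointKernel_apply, vadd_val,
    Measure.map_prod_map _ _ hs hs, Measure.map_apply hss hS]

/-- The pairs whose first point lies in the unit cube: a fundamental domain for the diagonal
translations. -/
def unitCell (d m : ℕ) : Set ((Space d × Fin m) × (Space d × Fin m)) :=
  (fun z => z.1.1) ⁻¹' cube 0 1

theorem measurableSet_unitCell : MeasurableSet (unitCell d m) :=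
  (isOpen_cube 0 1).measurableSet.preimage (by fun_prop)

theorem integral_secondMoment_eq_unitCell [SFinite μ]
    [VAddInvariantMeasure (Space d) (PointMeasure d m) μ] {F : Type*} [NormedAddCommGroup F]
    [NormedSpace ℝ F] {Φ : (Space d × Fin m) × (Space d × Fin m) → F}
    (hΦ : Integrable Φ (secondMoment μ)) :
    ∫ z, Φ z ∂secondMoment μ =
      ∫ z in unitCell d m, (∫ t, Φ (shift m t z.1, shift m t z.2)) ∂secondMoment μ := by
  have hs : Measurable (Function.uncurry fun t : Space d => Prod.map (shift m t) (shift m t)) := by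
    change Measurable fun x : Space d × ((Space d × Fin m) × (Space d × Fin m)) =>
      ((x.1 + x.2.1.1, x.2.1.2), (x.1 + x.2.2.1, x.2.2.2))
    fun_prop
  simpa [unitCell, Measure.real, volume_cube_one, Prod.map] using
    integral_eq_integral_preimage_integral (v := volume) hs map_shift_secondMoment
      (by fun_prop : Measurable fun z : (Space d × Fin m) × (Space d × Fin m) => z.1.1)
      (fun _ _ => rfl) (isOpen_cube 0 1).measurableSet (by simp [volume_cube_one]) hΦ

theorem lintegral_secondMoment_le (hC : ∀ᵐ ν ∂μ, DecayBounded C ν) (b : Space d → Space d)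
    {Φ : (Space d × Fin m) × (Space d × Fin m) → ℝ≥0∞} (hΦm : Measurable Φ) {c : ℝ≥0∞}
    (hΦ : ∀ p q, Φ (p, q) ≤ c * decay (d + 1) p.1 * decay (d + 1) (q.1 - b p.1)) :
    ∫⁻ z, Φ z ∂secondMoment μ ≤ c * C * C * μ Set.univ := by
  rw [lintegral_secondMoment μ hΦm, ← lintegral_const]
  refine lintegral_mono_ae (hC.mono fun ν hν => ?_)
  have hm (a : Space d) : Measurable fun p : Space d × Fin m => decay (d + 1) (p.1 - a) :=
    (measurable_decay _).comp (by fun_prop)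
  calc ∫⁻ p, ∫⁻ q, Φ (p, q) ∂ν.1 ∂ν.1
      ≤ ∫⁻ p, c * C * decay (d + 1) (p.1 - 0) ∂ν.1 := lintegral_mono fun p => by
        calc ∫⁻ q, Φ (p, q) ∂ν.1
            ≤ ∫⁻ q, c * decay (d + 1) p.1 * decay (d + 1) (q.1 - b p.1) ∂ν.1 :=
              lintegral_mono (hΦ p)
          _ = c * decay (d + 1) p.1 * ∫⁻ q, decay (d + 1) (q.1 - b p.1) ∂ν.1 :=
              lintegral_const_mul _ (hm _)
          _ ≤ c * decay (d + 1) p.1 * C := by gcongr; exact hν (b p.1)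
          _ = c * C * decay (d + 1) (p.1 - 0) := by rw [sub_zero, mul_right_comm]
    _ = c * C * ∫⁻ p, decay (d + 1) (p.1 - 0) ∂ν.1 := lintegral_const_mul _ (hm 0)
    _ ≤ c * C * C := by gcongr; exact hν 0

end SecondMoment

section Autocorrelation

variable {d m : ℕ} {μ : Measure (PointMeasure d m)} {C : ℝ≥0}

/-- The integrand of the weighted autocorrelation against the second moment measure. -/
def autocorrelationKernel (w : Fin m → ℝ) (f : Space d → ℂ)
    (z : (Space d × Fin m) × (Space d × Fin m)) : ℂ :=
  w z.1.2 * (w z.2.2 * f (z.2.1 - z.1.1))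

theorem measurable_autocorrelationKernel (w : Fin m → ℝ) {f : Space d → ℂ} (hf : Measurable f) :
    Measurable (autocorrelationKernel w f) := by
  have hw : Measurable fun i => (w i : ℂ) := measurable_of_finite _
  exact (hw.comp (by fun_prop)).mul ((hw.comp (by fun_prop)).mul (hf.comp (by fun_prop)))

theorem exists_lintegral_autocorrelationKernel_le [IsFiniteMeasure μ]
    (hC : ∀ᵐ ν ∂μ, DecayBounded C ν) (w : Fin m → ℝ) :
    ∃ B : ℝ≥0, ∀ (f : Space d → ℂ) (S : ℝ≥0∞), Measurable f →
      (∀ x, ‖f x‖ₑ ≤ S * decay (d + 1) x) →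
      ∫⁻ z in unitCell d m, ‖autocorrelationKernel w f z‖ₑ ∂secondMoment μ ≤ B * S := by
  obtain ⟨R, hR⟩ := (isBounded_cube (0 : Space d) 1).exists_norm_le
  set K : ℝ≥0∞ := (1 + ENNReal.ofReal R) ^ (d + 1)
  have hB : ‖w‖ₑ * ‖w‖ₑ * K * C * C * μ Set.univ ≠ ⊤ := by finiteness
  refine ⟨(‖w‖ₑ * ‖w‖ₑ * K * C * C * μ Set.univ).toNNReal, fun f S hfm hf => ?_⟩
  rw [ENNReal.coe_toNNReal hB, ← lintegral_indicator measurableSet_unitCell]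
  refine (lintegral_secondMoment_le hC id (c := ‖w‖ₑ * ‖w‖ₑ * K * S)
    ((measurable_autocorrelationKernel w hfm).enorm.indicator measurableSet_unitCell)
    fun p q => ?_).trans_eq (by ring)
  refine Set.indicator_apply_le' (fun hp => ?_) fun _ => zero_le
  calc ‖autocorrelationKernel w f (p, q)‖ₑ
      = ‖(w p.2 : ℂ)‖ₑ * (‖(w q.2 : ℂ)‖ₑ * ‖f (q.1 - p.1)‖ₑ) * 1 := by
        rw [autocorrelationKernel, enorm_mul, enorm_mul, mul_one]
    _ ≤ ‖w‖ₑ * (‖w‖ₑ * (S * decay (d + 1) (q.1 - p.1))) * (K * decay (d + 1) p.1) := by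
        gcongr
        exacts [enorm_weight_le w p.2, enorm_weight_le w q.2, hf _, one_le_mul_decay _ (hR _ hp)]
    _ = _ := by simp only [id]; ring

theorem integrableOn_autocorrelationKernel [IsFiniteMeasure μ]
    (hC : ∀ᵐ ν ∂μ, DecayBounded C ν) (w : Fin m → ℝ) (f : 𝓢(Space d, ℂ)) :
    IntegrableOn (autocorrelationKernel w f) (unitCell d m) (secondMoment μ) := by
  obtain ⟨B, hB⟩ := exists_lintegral_autocorrelationKernel_le hC w
  have hf := f.continuous.measurable
  exact ⟨(measurable_autocorrelationKernel w hf).aestronglyMeasurable,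
    (hB f _ hf (enorm_schwartz_le_mul_decay ℂ _ f)).trans_lt (by finiteness)⟩

theorem weightedCount_vadd (w : Fin m → ℝ) (f : Space d → ℂ) (t : Space d)
    (ν : PointMeasure d m) :
    weightedCount w f (t +ᵥ ν) = ∫ q, (w q.2 : ℂ) * f (t + q.1) ∂ν.1 :=
  (shift m t).measurableEmbedding.integral_map _

theorem weightedAutocorrelation_eq [IsFiniteMeasure μ] (hC : ∀ᵐ ν ∂μ, DecayBounded C ν)
    (w : Fin m → ℝ) (f : 𝓢(Space d, ℂ)) : weightedAutocorrelation μ w f =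
      ∫ z in unitCell d m, autocorrelationKernel w f z ∂secondMoment μ := by
  have hint := (integrable_indicator_iff measurableSet_unitCell).2
    (integrableOn_autocorrelationKernel hC w f)
  rw [← integral_indicator measurableSet_unitCell, integral_secondMoment hint]
  refine integral_congr_ae (ae_of_all _ fun ν => ?_)
  simp only
  rw [← integral_indicator ((isOpen_cube 0 1).measurableSet.prod MeasurableSet.univ)]
  refine integral_congr_ae (ae_of_all _ fun p => ?_)
  by_cases hp : p.1 ∈ cube (0 : Space d) 1
  · simp [unitCell, hp, autocorrelationKernel, weightedCount_vadd, integral_const_mul,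
      neg_add_eq_sub]
  · simp [unitCell, hp]

theorem exists_continuousLinearMap_eq_weightedAutocorrelation [IsFiniteMeasure μ]
    (hC : ∀ᵐ ν ∂μ, DecayBounded C ν) (w : Fin m → ℝ) :
    ∃ T : 𝓢(Space d, ℂ) →L[ℂ] ℂ, ∀ f, T f = weightedAutocorrelation μ w f := by
  obtain ⟨B, hB⟩ := exists_lintegral_autocorrelationKernel_le hC w
  refine ⟨SchwartzMap.mkCLMtoNormedSpace (fun f => weightedAutocorrelation μ w f)
    (fun f g => ?_) (fun c f => ?_) ⟨Finset.Iic (d + 1, 0), B * 2 ^ (d + 1), by positivity,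
      fun f => ?_⟩, fun f => rfl⟩
  · simp only [weightedAutocorrelation_eq hC]
    rw [← integral_add (integrableOn_autocorrelationKernel hC w f)
      (integrableOn_autocorrelationKernel hC w g)]
    simp only [autocorrelationKernel, add_apply, mul_add]
  · simp only [weightedAutocorrelation_eq hC]
    rw [RingHom.id_apply, ← integral_smul]
    simp only [autocorrelationKernel, smul_apply, mul_smul_comm]
  · have h := (enorm_integral_le_lintegral_enorm _).trans
      (hB f _ f.continuous.measurable (enorm_schwartz_le_mul_decay ℂ _ f))
    rw [← weightedAutocorrelation_eq hC, ← ofReal_norm, ← ENNReal.ofReal_coe_nnreal,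
      ← ENNReal.ofReal_mul B.coe_nonneg, ENNReal.ofReal_le_ofReal_iff (by positivity),
      ← mul_assoc] at h
    exact h

theorem integrable_weight_mul_conj_secondMoment [IsFiniteMeasure μ]
    (hC : ∀ᵐ ν ∂μ, DecayBounded C ν) (w : Fin m → ℝ) (h : 𝓢(Space d, ℂ)) :
    Integrable (fun z => ((w z.1.2 : ℂ) * h z.1.1) * conj ((w z.2.2 : ℂ) * h z.2.1))
      (secondMoment μ) := by
  have hwm := measurable_weight_mul w h.continuous.measurable
  have hm : Measurable fun z : (Space d × Fin m) × (Space d × Fin m) =>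
      ((w z.1.2 : ℂ) * h z.1.1) * conj ((w z.2.2 : ℂ) * h z.2.1) :=
    (hwm.comp measurable_fst).mul
      (Complex.continuous_conj.measurable.comp (hwm.comp measurable_snd))
  set S := ENNReal.ofReal (2 ^ (d + 1) *
    (Finset.Iic (d + 1, 0)).sup (schwartzSeminormFamily ℂ (Space d) ℂ) h)
  have hle (p : Space d × Fin m) : ‖(w p.2 : ℂ) * h p.1‖ₑ ≤ ‖w‖ₑ * (S * decay (d + 1) p.1) := by
    rw [enorm_mul]
    gcongr
    exacts [enorm_weight_le w p.2, enorm_schwartz_le_mul_decay ℂ _ h p.1]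
  refine ⟨hm.aestronglyMeasurable, (lintegral_secondMoment_le hC 0
    (c := ‖w‖ₑ * S * (‖w‖ₑ * S)) hm.enorm fun p q => ?_).trans_lt (by finiteness)⟩
  calc ‖((w p.2 : ℂ) * h p.1) * conj ((w q.2 : ℂ) * h q.1)‖ₑ
      = ‖(w p.2 : ℂ) * h p.1‖ₑ * ‖(w q.2 : ℂ) * h q.1‖ₑ := by
        rw [enorm_mul, RCLike.enorm_conj]
    _ ≤ ‖w‖ₑ * (S * decay (d + 1) p.1) * (‖w‖ₑ * (S * decay (d + 1) q.1)) := by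
        gcongr <;> apply hle
    _ = _ := by simp only [Pi.zero_apply, sub_zero]; ring

theorem integral_norm_weightedCount_sq [IsFiniteMeasure μ]
    [VAddInvariantMeasure (Space d) (PointMeasure d m) μ] (hC : ∀ᵐ ν ∂μ, DecayBounded C ν)
    (w : Fin m → ℝ) (h : 𝓢(Space d, ℂ)) :
    ((∫ ν, ‖weightedCount w h ν‖ ^ 2 ∂μ : ℝ) : ℂ) =
      weightedAutocorrelation μ w
        (𝓕 (schwartzOfReal (schwartzNormSq (𝓕 h))) : 𝓢(Space d, ℂ)) := by
  have hint := integrable_weight_mul_conj_secondMoment hC w h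
  calc ((∫ ν, ‖weightedCount w h ν‖ ^ 2 ∂μ : ℝ) : ℂ)
      = ∫ ν, weightedCount w h ν * conj (weightedCount w h ν) ∂μ := by
        rw [← integral_complex_ofReal]
        simp only [Complex.mul_conj, Complex.normSq_eq_norm_sq]
    _ = ∫ z, ((w z.1.2 : ℂ) * h z.1.1) * conj ((w z.2.2 : ℂ) * h z.2.1) ∂secondMoment μ := by
        rw [integral_secondMoment hint]
        simp only [integral_const_mul, integral_mul_const, integral_conj, weightedCount]
    _ = ∫ z in unitCell d m, (∫ t, ((w z.1.2 : ℂ) * h (t + z.1.1)) *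
          conj ((w z.2.2 : ℂ) * h (t + z.2.1))) ∂secondMoment μ :=
        integral_secondMoment_eq_unitCell hint
    _ = ∫ z in unitCell d m, autocorrelationKernel w
          (𝓕 (schwartzOfReal (schwartzNormSq (𝓕 h))) : 𝓢(Space d, ℂ)) z ∂secondMoment μ := by
        simp only [autocorrelationKernel, ← integral_mul_conj_translate, ← integral_const_mul,
          map_mul, Complex.conj_ofReal]
        congr! 4
        ring
    _ = _ := (weightedAutocorrelation_eq hC w _).symm

end Autocorrelation

section ExtendIsometry

theorem exists_linearIsometry_eq_of_denseRange {𝕜 E F G : Type*} [RCLike 𝕜] [AddCommGroup E]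
    [Module 𝕜 E] [NormedAddCommGroup F] [NormedSpace 𝕜 F] [NormedAddCommGroup G] [NormedSpace 𝕜 G]
    [CompleteSpace G] {e : E →ₗ[𝕜] F} (he : DenseRange e) {f : E →ₗ[𝕜] G}
    (hf : ∀ x, ‖f x‖ = ‖e x‖) : ∃ θ : F →ₗᵢ[𝕜] G, ∀ x, θ (e x) = f x := by
  have hbd : ∃ c, ∀ x, ‖f x‖ ≤ c * ‖e x‖ := ⟨1, fun x => by rw [hf, one_mul]⟩
  have hθ (x : E) : f.extendOfNorm e (e x) = f x := LinearMap.extendOfNorm_eq he hbd x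
  refine ⟨⟨(f.extendOfNorm e).toLinearMap, fun y => ?_⟩, hθ⟩
  refine he.induction_on (p := fun y => ‖f.extendOfNorm e y‖ = ‖y‖) y
    (isClosed_eq (by fun_prop) (by fun_prop)) fun x => ?_
  rw [hθ, hf]

end ExtendIsometry

section NormSquare

theorem ofReal_norm_sq_Lp {α : Type*} [MeasurableSpace α] {μ : Measure α} (g : Lp ℂ 2 μ) :
    ((‖g‖ ^ 2 : ℝ) : ℂ) = ∫ x, ((‖g x‖ ^ 2 : ℝ) : ℂ) ∂μ := by
  rw [Complex.ofReal_pow]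
  refine ((inner_self_eq_norm_sq_to_K (𝕜 := ℂ) g).symm.trans (L2.inner_def g g)).trans ?_
  simp only [inner_self_eq_norm_sq_to_K, Complex.ofReal_pow, Complex.coe_algebraMap]

theorem ofReal_norm_sq_schwartz_toLp {E : Type*} [NormedAddCommGroup E] [NormedSpace ℝ E]
    [MeasurableSpace E] [OpensMeasurableSpace E] [SecondCountableTopology E] (σ : Measure E)
    [σ.HasTemperateGrowth] (ψ : 𝓢(E, ℂ)) :
    ((‖ψ.toLp 2 σ‖ ^ 2 : ℝ) : ℂ) = ∫ x, schwartzOfReal (schwartzNormSq ψ) x ∂σ := by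
  rw [ofReal_norm_sq_Lp]
  exact integral_congr_ae ((ψ.coeFn_toLp 2 σ).mono fun x hx => by
    simp only [hx, schwartzOfReal_apply, schwartzNormSq_apply])

end NormSquare

section Embedding

variable {d m : ℕ} {μ : Measure (PointMeasure d m)} [IsFiniteMeasure μ] {C : ℝ≥0}

theorem memLp_weightedCount (hC : ∀ᵐ ν ∂μ, DecayBounded C ν) (w : Fin m → ℝ) (f : 𝓢(Space d, ℂ)) :
    MemLp (weightedCount w f) 2 μ :=
  (memLp_top_weightedCount hC w f).mono_exponent le_top

/-- The weighted counting functions of a uniformly discrete process, as a linear map into `L²`. -/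
def weightedCountLp (hC : ∀ᵐ ν ∂μ, DecayBounded C ν) (w : Fin m → ℝ) :
    𝓢(Space d, ℂ) →ₗ[ℂ] Lp ℂ 2 μ where
  toFun f := (memLp_weightedCount hC w f).toLp
  map_add' f g := by
    rw [← MemLp.toLp_add]
    refine MemLp.toLp_congr _ _ (hC.mono fun ν hν => ?_)
    simp only [Pi.add_apply, weightedCount, add_apply, mul_add,
      integral_add (hν.integrable_weight_mul w f) (hν.integrable_weight_mul w g)]
  map_smul' c f := by
    rw [RingHom.id_apply, ← MemLp.toLp_const_smul]
    refine MemLp.toLp_congr _ _ (ae_of_all _ fun ν => ?_)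
    simp only [Pi.smul_apply, weightedCount, smul_apply, mul_smul_comm, integral_smul]

theorem weightedCountLp_ae_eq (hC : ∀ᵐ ν ∂μ, DecayBounded C ν) (w : Fin m → ℝ)
    (f : 𝓢(Space d, ℂ)) : weightedCountLp hC w f =ᵐ[μ] weightedCount w f :=
  (memLp_weightedCount hC w f).coeFn_toLp

variable [VAddInvariantMeasure (Space d) (PointMeasure d m) μ]

theorem ofReal_norm_sq_weightedCountLp (hC : ∀ᵐ ν ∂μ, DecayBounded C ν) (w : Fin m → ℝ)
    (h : 𝓢(Space d, ℂ)) : ((‖weightedCountLp hC w h‖ ^ 2 : ℝ) : ℂ) =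
      weightedAutocorrelation μ w
        (𝓕 (schwartzOfReal (schwartzNormSq (𝓕 h))) : 𝓢(Space d, ℂ)) := by
  rw [← integral_norm_weightedCount_sq hC, ← integral_complex_ofReal, ofReal_norm_sq_Lp]
  exact integral_congr_ae ((weightedCountLp_ae_eq hC w h).mono fun ν hν => by simp only [hν])

theorem exists_diffraction (hC : ∀ᵐ ν ∂μ, DecayBounded C ν) (w : Fin m → ℝ) :
    ∃ (σ : Measure (Space d)) (_ : σ.HasTemperateGrowth), IsFiniteMeasureOnCompacts σ ∧
      IsDiffraction μ w σ := by
  obtain ⟨T, hT⟩ := exists_continuousLinearMap_eq_weightedAutocorrelation hC w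
  have hpos (ψ : 𝓢(Space d, ℂ)) :
      0 ≤ (T ∘L FourierTransform.fourierCLM ℂ 𝓢(Space d, ℂ))
        (schwartzOfReal (schwartzNormSq ψ)) := by
    have h := ofReal_norm_sq_weightedCountLp hC w (𝓕⁻ ψ)
    rw [FourierTransform.fourier_fourierInv_eq, ← hT] at h
    exact (Complex.zero_le_real.2 (sq_nonneg _)).trans_eq h
  obtain ⟨σ, hσ, hfin, hint⟩ := exists_measure_of_nonneg_on_normSq hpos
  exact ⟨σ, hσ, hfin, fun φ => (hint φ).trans (hT (𝓕 φ))⟩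

theorem exists_diffractionEmbedding (hC : ∀ᵐ ν ∂μ, DecayBounded C ν) (w : Fin m → ℝ)
    {σ : Measure (Space d)} [σ.HasTemperateGrowth] [IsFiniteMeasureOnCompacts σ]
    (hσ : IsDiffraction μ w σ) :
    ∃ θ : Lp ℂ 2 σ →ₗᵢ[ℂ] Lp ℂ 2 μ, IsDiffractionEmbedding μ w σ θ := by
  let F : 𝓢(Space d, ℂ) →ₗ[ℂ] Lp ℂ 2 μ :=
    weightedCountLp hC w ∘ₗ (FourierTransform.fourierInvCLM ℂ 𝓢(Space d, ℂ)).toLinearMap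
  have hnorm (ψ : 𝓢(Space d, ℂ)) : ‖F ψ‖ = ‖SchwartzMap.toLpCLM ℂ ℂ 2 σ ψ‖ := by
    have h : ((‖F ψ‖ ^ 2 : ℝ) : ℂ) = ((‖ψ.toLp 2 σ‖ ^ 2 : ℝ) : ℂ) := by
      rw [ofReal_norm_sq_schwartz_toLp, hσ]
      refine (ofReal_norm_sq_weightedCountLp hC w (𝓕⁻ ψ)).trans ?_
      rw [FourierTransform.fourier_fourierInv_eq]
    exact (sq_eq_sq₀ (norm_nonneg _) (norm_nonneg _)).1 (Complex.ofReal_injective h)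
  obtain ⟨θ, hθ⟩ := exists_linearIsometry_eq_of_denseRange
    (e := (SchwartzMap.toLpCLM ℂ ℂ 2 σ).toLinearMap)
    (SchwartzMap.denseRange_toLpCLM (by norm_num)) hnorm
  have hθ𝓕 (f : 𝓢(Space d, ℂ)) : θ ((𝓕 f).toLp 2 σ) = weightedCountLp hC w f := by
    refine (hθ (𝓕 f)).trans ?_
    change weightedCountLp hC w (𝓕⁻ (𝓕 f)) = _
    rw [FourierTransform.fourierInv_fourier_eq]
  exact ⟨θ, fun f => hθ𝓕 f ▸ weightedCountLp_ae_eq hC w f⟩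

end Embedding

section BoundedConvergence

variable {Ω E : Type*} [MeasurableSpace Ω] {μ : Measure Ω} [NormedAddCommGroup E]
  {G : ℕ → Ω → E} {H : Ω → E} {c : ℝ}

theorem memLp_top_of_tendsto_ae (hG : ∀ n, AEStronglyMeasurable (G n) μ)
    (hc : ∀ n, ∀ᵐ x ∂μ, ‖G n x‖ ≤ c) (hlim : ∀ᵐ x ∂μ, Tendsto (G · x) atTop (𝓝 (H x))) :
    MemLp H ∞ μ := by
  refine memLp_top_of_bound (aestronglyMeasurable_of_tendsto_ae atTop hG hlim) c ?_
  filter_upwards [hlim, ae_all_iff.2 hc] with x hx hcx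
  exact le_of_tendsto' hx.norm hcx

theorem unifIntegrable_of_norm_le {p : ℝ≥0∞} (hp : 1 ≤ p) (hp' : p ≠ ⊤)
    (hG : ∀ n, AEStronglyMeasurable (G n) μ) (hc : ∀ n, ∀ᵐ x ∂μ, ‖G n x‖ ≤ c) :
    UnifIntegrable G p μ := by
  refine unifIntegrable_of hp hp' hG fun ε _ => ⟨(c + 1).toNNReal, fun n => ?_⟩
  have hzero : Set.indicator {x | (c + 1).toNNReal ≤ ‖G n x‖₊} (G n) =ᵐ[μ] 0 := by
    filter_upwards [hc n] with x hx
    refine Set.indicator_of_notMem (fun h => ?_) _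
    have h' : c + 1 ≤ ‖G n x‖ := Real.toNNReal_le_iff_le_coe.1 h.out
    linarith
  rw [eLpNorm_congr_ae hzero, eLpNorm_zero]
  exact zero_le

theorem tendsto_eLpNorm_sub_of_norm_le [IsFiniteMeasure μ] {p : ℝ≥0∞} (hp : 1 ≤ p) (hp' : p ≠ ⊤)
    (hG : ∀ n, AEStronglyMeasurable (G n) μ) (hc : ∀ n, ∀ᵐ x ∂μ, ‖G n x‖ ≤ c)
    (hlim : ∀ᵐ x ∂μ, Tendsto (G · x) atTop (𝓝 (H x))) :
    Tendsto (fun n => eLpNorm (G n - H) p μ) atTop (𝓝 0) :=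
  tendsto_Lp_finite_of_tendsto_ae hp hp' hG
    ((memLp_top_of_tendsto_ae hG hc hlim).mono_exponent le_top)
    (unifIntegrable_of_norm_le hp hp' hG hc) hlim

end BoundedConvergence

section FunctionAlgebra

variable {Ω 𝕜 : Type*} [RCLike 𝕜] {A : Subalgebra 𝕜 (Ω → 𝕜)}

theorem indicator_compl_mem {s : Set Ω} (hs : s.indicator 1 ∈ A) : sᶜ.indicator 1 ∈ A := by
  rw [Set.indicator_compl]
  exact sub_mem A.one_mem hs

theorem indicator_accumulate_mem {s : ℕ → Set Ω} (hs : ∀ n, (s n).indicator 1 ∈ A) (n : ℕ) :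
    (Set.accumulate s n).indicator 1 ∈ A := by
  induction n with
  | zero => rw [Set.accumulate_zero_nat]; exact hs 0
  | succ n ih =>
    rw [Set.accumulate_succ, ← compl_compl (_ ∪ _), Set.compl_union]
    refine indicator_compl_mem ?_
    rw [Set.inter_indicator_one]
    exact mul_mem (indicator_compl_mem ih) (indicator_compl_mem (hs _))

theorem polynomial_eval_ofReal_mem {f : Ω → ℝ} (hf : (fun x => (f x : 𝕜)) ∈ A) (p : Polynomial ℝ) :
    (fun x => ((p.eval (f x) : ℝ) : 𝕜)) ∈ A := by
  convert (Polynomial.aeval (⟨_, hf⟩ : A) (p.map (algebraMap ℝ 𝕜))).2 using 1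
  rw [Polynomial.aeval_subalgebra_coe]
  funext x
  rw [Polynomial.aeval_fn_apply, Polynomial.aeval_map_algebraMap]
  exact (Polynomial.aeval_algebraMap_apply_eq_algebraMap_eval (f x) p).symm

end FunctionAlgebra

section BoundedlyClosed

variable {Ω 𝕜 : Type*} [RCLike 𝕜] [MeasurableSpace Ω] {μ : Measure Ω}
  {A : Subalgebra 𝕜 (Ω → 𝕜)}

/-- An algebra of essentially bounded functions that is closed under bounded almost everywhere
convergence, as in the monotone class theorem. -/
structure IsBoundedlyClosed (μ : Measure Ω) (A : Subalgebra 𝕜 (Ω → 𝕜)) : Prop where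
  memLp_top : ∀ F ∈ A, MemLp F ∞ μ
  mem_of_tendsto {G : ℕ → Ω → 𝕜} {H : Ω → 𝕜} {c : ℝ} (hG : ∀ n, G n ∈ A)
    (hc : ∀ n, ∀ᵐ x ∂μ, ‖G n x‖ ≤ c) (hlim : ∀ᵐ x ∂μ, Tendsto (G · x) atTop (𝓝 (H x))) : H ∈ A

theorem ae_norm_le_of_memLp_top {F : Ω → 𝕜} (hF : MemLp F ∞ μ) :
    ∃ c : ℝ, ∀ᵐ x ∂μ, ‖F x‖ ≤ c := by
  refine ⟨(eLpNorm F ∞ μ).toReal, (ae_le_eLpNormEssSup (f := F) (μ := μ)).mono fun x hx => ?_⟩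
  rw [← toReal_enorm]
  exact ENNReal.toReal_mono hF.2.ne (hx.trans_eq eLpNorm_exponent_top.symm)

namespace IsBoundedlyClosed

theorem mem_of_ae_eq (hA : IsBoundedlyClosed μ A) {F G : Ω → 𝕜} (hF : F ∈ A) (h : F =ᵐ[μ] G) :
    G ∈ A := by
  obtain ⟨c, hc⟩ := ae_norm_le_of_memLp_top (hA.memLp_top F hF)
  exact hA.mem_of_tendsto (fun _ => hF) (fun _ => hc) (h.mono fun x hx => hx ▸ tendsto_const_nhds)

theorem indicator_iUnion_mem (hA : IsBoundedlyClosed μ A) {s : ℕ → Set Ω}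
    (hs : ∀ n, (s n).indicator 1 ∈ A) : (⋃ n, s n).indicator 1 ∈ A := by
  refine hA.mem_of_tendsto (indicator_accumulate_mem hs) (c := 1)
    (fun n => ae_of_all _ fun x => ?_) (ae_of_all _ fun x => ?_)
  · exact (norm_indicator_le_norm_self _ _).trans (by simp)
  · rw [← Set.iUnion_accumulate]
    exact (Set.monotone_accumulate.tendsto_indicator _ (1 : Ω → 𝕜) x).mono_right (pure_le_nhds _)

/-- The `σ`-algebra of the sets whose indicator functions belong to a boundedly closed algebra. -/
abbrev measurableSpace (hA : IsBoundedlyClosed μ A) : MeasurableSpace Ω where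
  MeasurableSet' s := s.indicator 1 ∈ A
  measurableSet_empty := by rw [Set.indicator_empty]; exact A.zero_mem
  measurableSet_compl _ := indicator_compl_mem
  measurableSet_iUnion _ := hA.indicator_iUnion_mem

theorem measurableSet_of_measure_eq_zero (hA : IsBoundedlyClosed μ A) {s : Set Ω} (hs : μ s = 0) :
    MeasurableSet[hA.measurableSpace] s :=
  hA.mem_of_ae_eq A.zero_mem (indicator_meas_zero hs).symm

theorem comp_ofReal_mem (hA : IsBoundedlyClosed μ A) {f : Ω → ℝ}
    (hf : (fun x => (f x : 𝕜)) ∈ A) {g : ℝ → ℝ} (hg : Continuous g) :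
    (fun x => (g (f x) : 𝕜)) ∈ A := by
  obtain ⟨c, hc⟩ := ae_norm_le_of_memLp_top (hA.memLp_top _ hf)
  have hfc : ∀ᵐ x ∂μ, f x ∈ Set.Icc (-c) c := hc.mono fun x hx => by
    rwa [RCLike.norm_ofReal, abs_le] at hx
  obtain ⟨b, hb⟩ :=
    isCompact_Icc.exists_bound_of_continuousOn (s := Set.Icc (-c) c) hg.continuousOn
  choose p hp using fun n : ℕ => exists_polynomial_near_of_continuousOn (-c) c g hg.continuousOn
    (1 / ((n : ℝ) + 1)) Nat.one_div_pos_of_nat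
  refine hA.mem_of_tendsto (fun n => polynomial_eval_ofReal_mem hf (p n)) (c := 1 + b)
    (fun n => hfc.mono fun x hx => ?_) (hfc.mono fun x hx => ?_)
  · rw [RCLike.norm_ofReal, ← Real.norm_eq_abs]
    have hle : ‖(p n).eval (f x) - g (f x)‖ ≤ 1 :=
      (hp n _ hx).le.trans (Nat.one_div_le_one_div n.zero_le |>.trans (by simp))
    exact (norm_le_norm_sub_add _ (g (f x))).trans (add_le_add hle (hb _ hx))
  · refine (RCLike.continuous_ofReal (K := 𝕜).tendsto _).comp
      (tendsto_iff_norm_sub_tendsto_zero.2 ?_)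
    exact squeeze_zero (fun _ => norm_nonneg _) (fun n => (hp n _ hx).le)
      tendsto_one_div_add_atTop_nhds_zero_nat

theorem measurable_of_ofReal_mem (hA : IsBoundedlyClosed μ A) {f : Ω → ℝ}
    (hf : (fun x => (f x : 𝕜)) ∈ A) : Measurable[hA.measurableSpace] f := by
  refine @measurable_of_isClosed _ _ _ _ _ hA.measurableSpace _ fun s hs => ?_
  refine hA.mem_of_tendsto (c := 1) (fun n => hA.comp_ofReal_mem hf
    (g := fun t => hs.apprSeq n t) (by fun_prop)) (fun n => ae_of_all _ fun x => ?_)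
    (ae_of_all _ fun x => ?_)
  · simpa using HasOuterApproxClosed.apprSeq_apply_le_one hs n (f x)
  · have h := tendsto_pi_nhds.1 (HasOuterApproxClosed.tendsto_apprSeq hs) (f x)
    have hcont := RCLike.continuous_ofReal (K := 𝕜).comp NNReal.continuous_coe
    convert (hcont.tendsto _).comp h using 2
    · rfl
    · by_cases hx : f x ∈ s <;> simp [Set.indicator, hx]

end IsBoundedlyClosed

end BoundedlyClosed

section LpClosure

variable {Ω 𝕜 : Type*} [RCLike 𝕜] [mΩ : MeasurableSpace Ω] {μ : Measure Ω} {p : ℝ≥0∞}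
  {A : Subalgebra 𝕜 (Ω → 𝕜)}

/-- The function `G` belongs to the closure of `A` for the seminorm of `L^p(μ)`. -/
def IsLpApproximable (p : ℝ≥0∞) (μ : Measure Ω) (A : Subalgebra 𝕜 (Ω → 𝕜)) (G : Ω → 𝕜) : Prop :=
  ∀ ε : ℝ≥0∞, ε ≠ 0 → ∃ F ∈ A, eLpNorm (G - F) p μ ≤ ε

namespace IsLpApproximable

theorem of_mem {F : Ω → 𝕜} (hF : F ∈ A) : IsLpApproximable p μ A F :=
  fun ε _ => ⟨F, hF, by simp⟩

theorem of_forall_eLpNorm_sub_le (hp : 1 ≤ p) (hA : ∀ F ∈ A, AEStronglyMeasurable F μ)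
    {G : Ω → 𝕜} (hG : AEStronglyMeasurable G μ)
    (h : ∀ ε : ℝ≥0∞, ε ≠ 0 → ∃ H, AEStronglyMeasurable H μ ∧ IsLpApproximable p μ A H ∧
      eLpNorm (G - H) p μ ≤ ε) : IsLpApproximable p μ A G := by
  intro ε hε
  have hε2 : ε / 2 ≠ 0 := (ENNReal.half_pos hε).ne'
  obtain ⟨H, hHm, hH, hGH⟩ := h _ hε2
  obtain ⟨F, hF, hHF⟩ := hH _ hε2
  refine ⟨F, hF, ?_⟩
  calc eLpNorm (G - F) p μ = eLpNorm ((G - H) + (H - F)) p μ := by rw [sub_add_sub_cancel]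
    _ ≤ eLpNorm (G - H) p μ + eLpNorm (H - F) p μ :=
        eLpNorm_add_le (hG.sub hHm) (hHm.sub (hA F hF)) hp
    _ ≤ ε / 2 + ε / 2 := add_le_add hGH hHF
    _ = ε := ENNReal.add_halves ε

theorem add (hp : 1 ≤ p) (hA : ∀ F ∈ A, AEStronglyMeasurable F μ) {G H : Ω → 𝕜}
    (hGm : AEStronglyMeasurable G μ) (hHm : AEStronglyMeasurable H μ)
    (hG : IsLpApproximable p μ A G) (hH : IsLpApproximable p μ A H) :
    IsLpApproximable p μ A (G + H) := by
  intro ε hε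
  have hε2 : ε / 2 ≠ 0 := (ENNReal.half_pos hε).ne'
  obtain ⟨F, hF, hGF⟩ := hG _ hε2
  obtain ⟨F', hF', hHF'⟩ := hH _ hε2
  refine ⟨F + F', add_mem hF hF', ?_⟩
  rw [add_sub_add_comm]
  exact (eLpNorm_add_le (hGm.sub (hA F hF)) (hHm.sub (hA F' hF')) hp).trans
    ((add_le_add hGF hHF').trans_eq (ENNReal.add_halves ε))

theorem exists_eLpNorm_mul_sub_le {K H : Ω → 𝕜} (hA : ∀ F ∈ A, AEStronglyMeasurable F μ)
    (hK : MemLp K ∞ μ) (hHm : AEStronglyMeasurable H μ) (hH : IsLpApproximable p μ A H)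
    {ε : ℝ≥0∞} (hε : ε ≠ 0) : ∃ F ∈ A, eLpNorm (K * H - K * F) p μ ≤ ε := by
  obtain ⟨F, hF, hHF⟩ := hH _ (ENNReal.div_ne_zero.2 ⟨hε, hK.2.ne⟩)
  refine ⟨F, hF, ?_⟩
  calc eLpNorm (K * H - K * F) p μ = eLpNorm (K • (H - F)) p μ := by rw [smul_eq_mul, mul_sub]
    _ ≤ eLpNorm K ∞ μ * eLpNorm (H - F) p μ :=
        eLpNorm_smul_le_eLpNorm_top_mul_eLpNorm p (hHm.sub (hA F hF)) K
    _ ≤ eLpNorm K ∞ μ * (ε / eLpNorm K ∞ μ) := by gcongr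
    _ ≤ ε := ENNReal.mul_div_le

theorem mul (hp : 1 ≤ p) (hA : ∀ F ∈ A, MemLp F ∞ μ) {G H : Ω → 𝕜} (hGb : MemLp G ∞ μ)
    (hHm : AEStronglyMeasurable H μ) (hG : IsLpApproximable p μ A G)
    (hH : IsLpApproximable p μ A H) : IsLpApproximable p μ A (G * H) := by
  have hAm (F) (hF : F ∈ A) := (hA F hF).1
  refine of_forall_eLpNorm_sub_le hp hAm (hGb.1.mul hHm) fun ε hε => ?_
  obtain ⟨F, hF, hGF⟩ := exists_eLpNorm_mul_sub_le hAm hGb hHm hH hε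
  refine ⟨G * F, hGb.1.mul (hAm F hF), fun δ hδ => ?_, hGF⟩
  obtain ⟨F', hF', hFF'⟩ := exists_eLpNorm_mul_sub_le hAm (hA F hF) hGb.1 hG hδ
  exact ⟨F * F', mul_mem hF hF', by rwa [mul_comm G F]⟩

end IsLpApproximable

/-- The essentially bounded functions in the `L^p`-closure of an algebra of essentially bounded
functions. -/
def boundedLpClosure (hp : 1 ≤ p) (hA : ∀ F ∈ A, MemLp F ∞ μ) : Subalgebra 𝕜 (Ω → 𝕜) where
  carrier := {G | MemLp G ∞ μ ∧ IsLpApproximable p μ A G}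
  mul_mem' hG hH := ⟨hH.1.mul hG.1, hG.2.mul hp hA hG.1 hH.1.1 hH.2⟩
  add_mem' hG hH := ⟨hG.1.add hH.1, hG.2.add hp (fun F hF => (hA F hF).1) hG.1.1 hH.1.1 hH.2⟩
  algebraMap_mem' c := ⟨hA _ (A.algebraMap_mem c), .of_mem (A.algebraMap_mem c)⟩

theorem isBoundedlyClosed_boundedLpClosure [IsFiniteMeasure μ] (hp : 1 ≤ p) (hp' : p ≠ ⊤)
    (hA : ∀ F ∈ A, MemLp F ∞ μ) : IsBoundedlyClosed μ (boundedLpClosure hp hA) where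
  memLp_top _ hF := hF.1
  mem_of_tendsto {G H c} hG hc hlim := by
    have hGm (n : ℕ) : AEStronglyMeasurable (G n) μ := (hG n).1.1
    have hH := memLp_top_of_tendsto_ae hGm hc hlim
    refine ⟨hH, .of_forall_eLpNorm_sub_le hp (fun F hF => (hA F hF).1) hH.1 fun ε hε => ?_⟩
    obtain ⟨n, hn⟩ := ((tendsto_eLpNorm_sub_of_norm_le hp hp' hGm hc hlim).eventually
      (gt_mem_nhds (pos_iff_ne_zero.2 hε))).exists
    exact ⟨G n, hGm n, (hG n).2, eLpNorm_sub_comm (G n) H p μ ▸ hn.le⟩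

theorem isLpApproximable_of_memLp [IsFiniteMeasure μ] (hp : 1 ≤ p) (hp' : p ≠ ⊤)
    (hA : ∀ F ∈ A, MemLp F ∞ μ)
    (hgen : ∀ 𝒢 : MeasurableSpace Ω, (∀ s, μ s = 0 → MeasurableSet[𝒢] s) →
      (∀ f : Ω → ℝ, (fun x => (f x : 𝕜)) ∈ A → Measurable[𝒢] f) → mΩ ≤ 𝒢)
    {G : Ω → 𝕜} (hG : MemLp G p μ) : IsLpApproximable p μ A G := by
  have hB := isBoundedlyClosed_boundedLpClosure hp hp' hA
  have hle : mΩ ≤ hB.measurableSpace := hgen _ (fun _ => hB.measurableSet_of_measure_eq_zero)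
    fun f hf => hB.measurable_of_ofReal_mem ⟨hA _ hf, .of_mem hf⟩
  have hind (c : 𝕜) {s : Set Ω} (hs : MeasurableSet s) {δ : ℝ≥0∞} (hδ : δ ≠ 0) :
      ∃ F, eLpNorm (F - s.indicator fun _ => c) p μ ≤ δ ∧ F ∈ A := by
    obtain ⟨F, hF, hδF⟩ := (Subalgebra.smul_mem _ (hle s hs) c).2 δ hδ
    have hsmul : c • s.indicator (1 : Ω → 𝕜) = s.indicator fun _ => c := by
      simpa using! (Set.indicator_const_smul s c (1 : Ω → 𝕜)).symm
    rw [hsmul, eLpNorm_sub_comm] at hδF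
    exact ⟨F, hδF, hF⟩
  intro ε hε
  obtain ⟨F, hGF, hF⟩ := MemLp.induction_dense hp' (· ∈ A) (fun c _ hs _ _ hδ => hind c hs hδ)
    (fun _ _ => add_mem) (fun F hF => (hA F hF).1) hG hε
  exact ⟨F, hF, hGF⟩

theorem dense_of_generates [IsFiniteMeasure μ] [Fact (1 ≤ p)] (hp' : p ≠ ⊤)
    (hA : ∀ F ∈ A, MemLp F ∞ μ)
    (hgen : ∀ 𝒢 : MeasurableSpace Ω, (∀ s, μ s = 0 → MeasurableSet[𝒢] s) →
      (∀ f : Ω → ℝ, (fun x => (f x : 𝕜)) ∈ A → Measurable[𝒢] f) → mΩ ≤ 𝒢) :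
    Dense {G : Lp 𝕜 p μ | ∃ F ∈ A, G =ᵐ[μ] F} := by
  refine EMetric.dense_iff.2 fun G ε hε => ?_
  obtain ⟨δ, hδ, hδε⟩ := exists_between hε
  obtain ⟨F, hF, hGF⟩ := isLpApproximable_of_memLp Fact.out hp' hA hgen (Lp.memLp G) δ hδ.ne'
  have hFp : MemLp F p μ := (hA F hF).mono_exponent le_top
  refine ⟨hFp.toLp, ?_, F, hF, hFp.coeFn_toLp⟩
  rw [Metric.mem_eball, edist_comm, Lp.edist_def]
  exact (eLpNorm_congr_ae (EventuallyEq.rfl.sub hFp.coeFn_toLp)).trans_le hGF |>.trans_lt hδε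

end LpClosure

section Recovery

theorem measurable_of_measurable_restrict {α β : Type*} [MeasurableSpace α] [MeasurableSpace β]
    {κ : α → Measure β} {B : ℕ → Set β} (hB : ∀ n, MeasurableSet (B n))
    (hBU : ⋃ n, B n = Set.univ) (hκ : ∀ n, Measurable fun x => (κ x).restrict (B n)) :
    Measurable κ := by
  refine Measure.measurable_of_measurable_coe _ fun T hT => ?_
  have hDm (n : ℕ) : MeasurableSet (disjointed B n) := .disjointed hB n
  have hsum (x : α) : κ x T = ∑' n, (κ x).restrict (B n) (T ∩ disjointed B n) := by
    conv_lhs => rw [← Set.inter_univ T, ← hBU, ← iUnion_disjointed, Set.inter_iUnion]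
    rw [measure_iUnion (fun _ _ hij => (disjoint_disjointed B hij).mono Set.inter_subset_right
      Set.inter_subset_right) fun n => hT.inter (hDm n)]
    exact tsum_congr fun n => (Measure.restrict_eq_self _
      (Set.inter_subset_right.trans (disjointed_subset B n))).symm
  simp only [hsum]
  exact .tsum fun n => (Measure.measurable_coe (hT.inter (hDm n))).comp (hκ n)

variable {d m : ℕ} {w : Fin m → ℝ} {ν : PointMeasure d m}

theorem restrict_eq_zero_or_dirac {Q : Set (Space d × Fin m)} (hQ : MeasurableSet Q)
    (hQc : IsCompact (closure Q)) (hν : ν.1 Q ≤ 1) :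
    ν.1.restrict Q = 0 ∨ ∃ p, ν.1.restrict Q = Measure.dirac p := by
  have : IsZeroOneMeasure (ν.1.restrict Q) := ⟨fun T hT => by
    rw [Measure.restrict_apply hT]
    obtain ⟨n, hn⟩ := ν.2 (T ∩ Q) (hT.inter hQ)
      (hQc.of_isClosed_subset isClosed_closure (closure_mono Set.inter_subset_right))
    have hn1 : n ≤ 1 := by
      exact_mod_cast hn ▸ (measure_mono Set.inter_subset_right).trans hν
    rw [hn]
    interval_cases n <;> simp⟩
  refine or_iff_not_imp_left.2 fun h => ?_
  have : NeZero (ν.1.restrict Q) := ⟨h⟩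
  exact IsZeroOneMeasure.exists_eq_dirac

/-- The weighted counting function of a real function. -/
def realCount (w : Fin m → ℝ) (f : Space d → ℝ) (ν : PointMeasure d m) : ℝ :=
  ∫ p, w p.2 * f p.1 ∂ν.1

theorem weightedCount_ofReal (w : Fin m → ℝ) (f : Space d → ℝ) (ν : PointMeasure d m) :
    weightedCount w (fun x => (f x : ℂ)) ν = realCount w f ν := by
  simp only [weightedCount, realCount, ← integral_complex_ofReal, Complex.ofReal_mul]

theorem realCount_eq_setIntegral (w : Fin m → ℝ) {f : Space d → ℝ} {U : Set (Space d)}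
    (hf : Function.support f ⊆ U) (ν : PointMeasure d m) :
    realCount w f ν = ∫ p in U ×ˢ Set.univ, w p.2 * f p.1 ∂ν.1 :=
  (setIntegral_eq_integral_of_forall_compl_eq_zero fun p hp => by
    rw [Function.notMem_support.1 fun h => hp ⟨hf h, trivial⟩, mul_zero]).symm

-- If there is a point `(x, j)` with `f x ≠ 0`, the quotient is `(w j * f x) ^ 2 / (w j * f x ^ 2)`,
-- that is, `w j`; otherwise it is `0 / 0 = 0`, which is not a weight.
theorem measure_support_prod_singleton (hinj : Function.Injective w) (hne : ∀ i, w i ≠ 0)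
    {f : Space d → ℝ} (hf : MeasurableSet (Function.support f)) (hfc : HasCompactSupport f)
    (hν : ν.1 (Function.support f ×ˢ Set.univ) ≤ 1) (i : Fin m) :
    ν.1 (Function.support f ×ˢ {i}) =
      Set.indicator {w i} 1 (realCount w f ν ^ 2 / realCount w (fun x => f x ^ 2) ν) := by
  have hsub : Function.support f ×ˢ {i} ⊆ Function.support f ×ˢ (Set.univ : Set (Fin m)) :=
    Set.prod_mono_right (Set.subset_univ _)
  have hcompact : IsCompact (closure (Function.support f ×ˢ (Set.univ : Set (Fin m)))) := by
    rw [closure_prod_eq, closure_univ]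
    exact IsCompact.prod hfc isCompact_univ
  rw [← Measure.restrict_eq_self _ hsub, realCount_eq_setIntegral w subset_rfl,
    realCount_eq_setIntegral w (Function.support_pow f two_ne_zero).subset]
  obtain h | ⟨p, h⟩ := restrict_eq_zero_or_dirac (hf.prod .univ) hcompact hν
  · simp [h, (hne i).symm]
  · rw [h, integral_dirac, integral_dirac, Measure.dirac_apply' _ (hf.prod (.singleton i))]
    by_cases hp : f p.1 = 0
    · simp [Set.indicator, hp, (hne i).symm]
    · have hquot : (w p.2 * f p.1) ^ 2 / (w p.2 * f p.1 ^ 2) = w p.2 := by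
        have := hne p.2
        field_simp
      simp [Set.indicator, hquot, hp, hinj.eq_iff]

variable {α : Type*} [MeasurableSpace α] {X : α → PointMeasure d m}

theorem measurable_measure_prod_singleton (hinj : Function.Injective w) (hne : ∀ i, w i ≠ 0)
    (hcount : ∀ f : Space d → ℝ, HasCompactSupport f → ContDiff ℝ ∞ f →
      Measurable fun x => realCount w f (X x))
    {U : Set (Space d)} (hU : IsOpen U) (hUb : Bornology.IsBounded U)
    (hX : ∀ x, (X x).1 (U ×ˢ Set.univ) ≤ 1) (i : Fin m) :
    Measurable fun x => (X x).1 (U ×ˢ {i}) := by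
  obtain ⟨f, rfl, hf, -⟩ := hU.exists_contDiff_support_eq (n := ⊤)
  have hfc : HasCompactSupport f := hUb.isCompact_closure
  have hfc2 : HasCompactSupport fun x => f x ^ 2 := hfc.comp_left (zero_pow two_ne_zero)
  simp only [measure_support_prod_singleton hinj hne hU.measurableSet hfc (hX _) i]
  exact (measurable_one.indicator (.singleton _)).comp
    (((hcount f hfc hf).pow_const 2).div (hcount _ hfc2 (hf.pow 2)))

theorem measurable_restrict_prod_univ (hinj : Function.Injective w) (hne : ∀ i, w i ≠ 0)
    (hcount : ∀ f : Space d → ℝ, HasCompactSupport f → ContDiff ℝ ∞ f →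
      Measurable fun x => realCount w f (X x))
    {U : Set (Space d)} (hU : IsOpen U) (hUb : Bornology.IsBounded U)
    (hX : ∀ x, (X x).1 (U ×ˢ Set.univ) ≤ 1) :
    Measurable fun x => (X x).1.restrict (U ×ˢ Set.univ) := by
  have hfin (x : α) : IsFiniteMeasure ((X x).1.restrict (U ×ˢ Set.univ)) :=
    ⟨by rw [Measure.restrict_apply_univ]; exact (hX x).trans_lt ENNReal.one_lt_top⟩
  have hrect (V : Set (Space d)) (hV : IsOpen V) (t : Set (Fin m)) :
      Measurable fun x => (X x).1.restrict (U ×ˢ Set.univ) (V ×ˢ t) := by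
    have hVU : IsOpen (V ∩ U) := hV.inter hU
    have hslices : (V ∩ U) ×ˢ t = ⋃ i ∈ t, (V ∩ U) ×ˢ {i} := by
      rw [← Set.prod_iUnion₂, Set.biUnion_of_singleton]
    have hsum (x : α) : (X x).1.restrict (U ×ˢ Set.univ) (V ×ˢ t) =
        ∑' i : t, (X x).1 ((V ∩ U) ×ˢ {i.1}) := by
      rw [Measure.restrict_apply' (hU.measurableSet.prod .univ), Set.prod_inter_prod,
        Set.inter_univ, hslices]
      exact measure_biUnion t.to_countable (fun i _ j _ hij => Set.disjoint_left.2
        fun p hp hq => hij (hp.2.symm.trans hq.2)) fun i _ => hVU.measurableSet.prod (.singleton i)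
    simp only [hsum]
    exact .tsum fun i => measurable_measure_prod_singleton hinj hne hcount hVU
      (hUb.subset Set.inter_subset_right)
      (fun x => (measure_mono (Set.prod_mono_left Set.inter_subset_right)).trans (hX x)) i
  have hspan : IsCountablySpanning {V : Set (Space d) | IsOpen V} :=
    ⟨fun _ => Set.univ, fun _ => isOpen_univ (X := Space d), Set.iUnion_const _⟩
  refine Measurable.measure_of_isPiSystem
    (S := Set.image2 (· ×ˢ ·) {V : Set (Space d) | IsOpen V} {t : Set (Fin m) | MeasurableSet t})
    ?_ (isPiSystem_isOpen.prod MeasurableSpace.isPiSystem_measurableSet) ?_ ?_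
  · rw [← generateFrom_prod_eq hspan isCountablySpanning_measurableSet,
      MeasurableSpace.generateFrom_measurableSet, ← borel, ← BorelSpace.measurable_eq]
  · rintro _ ⟨V, hV, t, -, rfl⟩
    exact hrect V hV t
  · rw [← Set.univ_prod_univ]
    exact hrect _ isOpen_univ _

theorem measurable_of_measurable_realCount (hinj : Function.Injective w) (hne : ∀ i, w i ≠ 0)
    (hcount : ∀ f : Space d → ℝ, HasCompactSupport f → ContDiff ℝ ∞ f →
      Measurable fun x => realCount w f (X x))
    {r : ℝ} (hr : 0 < r) (hX : ∀ x a, (X x).1 (cube a r ×ˢ Set.univ) ≤ 1) : Measurable X := by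
  have hcover : ⋃ n, cube (TopologicalSpace.denseSeq (Space d) n) r ×ˢ (Set.univ : Set (Fin m)) =
      Set.univ := by
    refine Set.eq_univ_of_forall fun p => ?_
    obtain ⟨n, hn⟩ := (TopologicalSpace.denseRange_denseSeq (Space d)).exists_dist_lt p.1
      (half_pos hr)
    exact Set.mem_iUnion.2 ⟨n, ball_subset_cube _ r hn, trivial⟩
  refine Measurable.subtype_mk (measurable_of_measurable_restrict
    (fun n => (isOpen_cube _ r).measurableSet.prod .univ) hcover fun n => ?_)
  exact measurable_restrict_prod_univ hinj hne hcount (isOpen_cube _ r) (isBounded_cube _ r)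
    fun x => hX x _

theorem measurableSpace_le_of_measurable_realCount {μ : Measure (PointMeasure d m)}
    (hμ : IsUniformlyDiscrete μ) (hinj : Function.Injective w) (hne : ∀ i, w i ≠ 0)
    {𝒢 : MeasurableSpace (PointMeasure d m)} (hnull : ∀ s, μ s = 0 → MeasurableSet[𝒢] s)
    (hcount : ∀ f : Space d → ℝ, HasCompactSupport f → ContDiff ℝ ∞ f →
      Measurable[𝒢] (realCount w f : PointMeasure d m → ℝ)) :
    instMeasurableSpacePointMeasure d m ≤ 𝒢 := by
  obtain ⟨r, hr, hdisc⟩ := hμ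
  set good := {ν : PointMeasure d m | ∀ a, ν.1 (cube a r ×ˢ Set.univ) ≤ 1}
  have hgood : MeasurableSet[𝒢] good := .of_compl (hnull _ hdisc)
  have hval : Measurable[𝒢.comap Subtype.val, instMeasurableSpacePointMeasure d m]
      (Subtype.val : good → PointMeasure d m) :=
    @measurable_of_measurable_realCount _ _ _ _ (𝒢.comap Subtype.val) _ hinj hne
      (fun f hfc hf => (hcount f hfc hf).comp (comap_measurable _)) _ hr fun x => x.2
  intro S hS
  rw [← Set.inter_union_compl S good, Set.inter_comm S good, ← Subtype.image_preimage_val]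
  exact .union (hgood.subtype_image (hval hS))
    (hnull _ (measure_mono_null Set.inter_subset_right hdisc))

end Recovery

section Density

variable {d m : ℕ} {μ : Measure (PointMeasure d m)} {w : Fin m → ℝ} {σ : Measure (Space d)}
  [σ.HasTemperateGrowth] {θ : Lp ℂ 2 σ →ₗᵢ[ℂ] Lp ℂ 2 μ}

namespace IsDiffractionEmbedding

theorem ae_eq_weightedCount_fourierInv (hθ : IsDiffractionEmbedding μ w σ θ) (φ : 𝓢(Space d, ℂ)) :
    θ (φ.toLp 2 σ) =ᵐ[μ] weightedCount w (𝓕⁻ φ : 𝓢(Space d, ℂ)) := by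
  have h := hθ (𝓕⁻ φ)
  rwa [FourierTransform.fourier_fourierInv_eq] at h

theorem weightedCount_mem_generatedAlgebra (hθ : IsDiffractionEmbedding μ w σ θ)
    (f : 𝓢(Space d, ℂ)) : (weightedCount w f : PointMeasure d m → ℂ) ∈ generatedAlgebra θ :=
  Algebra.subset_adjoin ⟨𝓕 f, (hθ f).symm⟩

theorem realCount_mem_generatedAlgebra (hθ : IsDiffractionEmbedding μ w σ θ) {f : Space d → ℝ}
    (hfc : HasCompactSupport f) (hf : ContDiff ℝ ∞ f) :
    (fun ν => (realCount w f ν : ℂ)) ∈ generatedAlgebra θ := by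
  simp only [← weightedCount_ofReal]
  exact hθ.weightedCount_mem_generatedAlgebra (schwartzOfReal (hfc.toSchwartzMap hf))

variable [IsFiniteMeasure μ]

theorem memLp_top_of_mem_generatedAlgebra (hθ : IsDiffractionEmbedding μ w σ θ) {C : ℝ≥0}
    (hC : ∀ᵐ ν ∂μ, DecayBounded C ν) {F : PointMeasure d m → ℂ} (hF : F ∈ generatedAlgebra θ) :
    MemLp F ∞ μ := by
  induction hF using Algebra.adjoin_induction with
  | mem F hF =>
    obtain ⟨φ, hφ⟩ := hF
    exact (memLp_congr_ae (hφ.trans (hθ.ae_eq_weightedCount_fourierInv φ))).2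
      (memLp_top_weightedCount hC w _)
  | algebraMap c => exact memLp_const c
  | add F G _ _ hF hG => exact hF.add hG
  | mul F G _ _ hF hG => exact hG.mul hF

theorem dense_generatedAlgebra (hθ : IsDiffractionEmbedding μ w σ θ)
    (hμ : IsUniformlyDiscrete μ) (hinj : Function.Injective w) (hne : ∀ i, w i ≠ 0) :
    Dense {G : Lp ℂ 2 μ | ∃ F ∈ generatedAlgebra θ, G =ᵐ[μ] F} := by
  obtain ⟨C, hC⟩ := hμ.exists_decayBounded
  exact dense_of_generates (by finiteness) (fun F => hθ.memLp_top_of_mem_generatedAlgebra hC)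
    fun 𝒢 hnull hreal => measurableSpace_le_of_measurable_realCount hμ hinj hne hnull
      fun f hfc hf => hreal _ (hθ.realCount_mem_generatedAlgebra hfc hf)

end IsDiffractionEmbedding

end Density

end ColouredPointProcess
end

open ColouredPointProcess in
theorem theorem6p1_general {d m : ℕ} {μ : Measure (PointMeasure d m)} [IsFiniteMeasure μ]
    [VAddInvariantMeasure (Space d) (PointMeasure d m) μ] (hμ : IsUniformlyDiscrete μ)
    {w : Fin m → ℝ} (hinj : Function.Injective w) (hne : ∀ i, w i ≠ 0) :
    (∃ (σ : Measure (Space d)) (_ : σ.HasTemperateGrowth) (θ : Lp ℂ 2 σ →ₗᵢ[ℂ] Lp ℂ 2 μ),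
        IsDiffraction μ w σ ∧ IsDiffractionEmbedding μ w σ θ) ∧
      ∀ (σ : Measure (Space d)) [σ.HasTemperateGrowth] (θ : Lp ℂ 2 σ →ₗᵢ[ℂ] Lp ℂ 2 μ),
        IsDiffractionEmbedding μ w σ θ →
          (∀ F ∈ generatedAlgebra θ, MemLp F 2 μ) ∧
            Dense {G : Lp ℂ 2 μ | ∃ F ∈ generatedAlgebra θ, G =ᵐ[μ] F} := by
  obtain ⟨C, hC⟩ := hμ.exists_decayBounded
  constructor
  · obtain ⟨σ, hσ, _, hdiff⟩ := exists_diffraction hC w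
    obtain ⟨θ, hθ⟩ := exists_diffractionEmbedding hC w hdiff
    exact ⟨σ, hσ, θ, hdiff, hθ⟩
  · intro σ _ θ hθ
    exact ⟨fun F hF => (hθ.memLp_top_of_mem_generatedAlgebra hC hF).mono_exponent le_top,
      hθ.dense_generatedAlgebra hμ hinj hne⟩

theorem theorem6p1 (d m : ℕ)
    (μ : Measure (ColouredPointProcess.PointMeasure d m)) [IsProbabilityMeasure μ]
    (hμ_disc : ColouredPointProcess.IsUniformlyDiscrete μ)
    (hμ_stat : VAddInvariantMeasure (ColouredPointProcess.Space d)
      (ColouredPointProcess.PointMeasure d m) μ)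
    (hμ_erg : ErgodicVAdd (ColouredPointProcess.Space d)
      (ColouredPointProcess.PointMeasure d m) μ)
    (w : Fin m → ℝ) (hw_inj : Function.Injective w) (hw_ne : ∀ i, w i ≠ 0) :
    (∃ (σ : Measure (ColouredPointProcess.Space d)) (_ : σ.HasTemperateGrowth)
        (θ : Lp ℂ 2 σ →ₗᵢ[ℂ] Lp ℂ 2 μ),
        ColouredPointProcess.IsDiffraction μ w σ ∧
        ColouredPointProcess.IsDiffractionEmbedding μ w σ θ) ∧
    ∀ (σ : Measure (ColouredPointProcess.Space d)) [σ.HasTemperateGrowth]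
      (θ : Lp ℂ 2 σ →ₗᵢ[ℂ] Lp ℂ 2 μ),
      ColouredPointProcess.IsDiffraction μ w σ →
      ColouredPointProcess.IsDiffractionEmbedding μ w σ θ →
      (∀ F ∈ ColouredPointProcess.generatedAlgebra θ, MemLp F 2 μ) ∧
      Dense {G : Lp ℂ 2 μ | ∃ F ∈ ColouredPointProcess.generatedAlgebra θ, G =ᵐ[μ] F} := by
  obtain ⟨hexists, hdense⟩ := theorem6p1_general hμ_disc hw_inj hw_ne
  exact ⟨hexists, fun σ _ θ _ hθ => hdense σ θ hθ⟩
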